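/- Let $(K,v)$ be a field of characteristic $p>0$ with a (Krull) valuation $v$, written additively, with value group $vK$ and valuation ring $\mathcal O$, and let $K^p$ be the subfield of $p$-th powers, endowed with the restriction of $v$; its value group is $vK^p=p\cdot vK$. A finite extension $L$ of a valued field $(F,v)$ is called defectless if equality holds in the fundamental inequality, i.e. $[L:F]=\sum_{i=1}^{g}(v_iL:vF)\,[Lv_i:Fv]$, where $v_1,\dots,v_g$ are the distinct extensions of $v$ from $F$ to $L$; if the extension is unique this reads $[L:F]=(vL:vF)\,[Lv:Fv]$. $(K,v)$ is called inseparably defectless if every finite purely inseparable extension of $K$ is defectless. For a polynomial $f\in K[X_1,\dots,X_n]$, $(K,v)$ is called $K$-extremal (respectively $\mathcal O$-extremal) with respect to $f$ if the set $\{v f(a_1,\dots,a_n)\}\subseteq vK\cup\{\infty\}$, with $a_1,\dots,a_n$ ranging over $K$ (respectively over $\mathcal O$), has a maximum. A basis $b_1,\dots,b_n$ of a finite extension $L$ of a field $F$, with a valuation $v$ on $L$, is called a valuation basis if $v\sum_i c_ib_i=\min_i v(c_ib_i)$ for all $c_1,\dots,c_n\in F$. A $\mathbb Z$-group is an ordered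 abelian group $G$ that has a least positive element $\alpha$ and for which $G/\mathbb Z\alpha$ is divisible. **Theorem.** (1) $(K,v)$ is inseparably defectless if and only if it is $K$-extremal with respect to every polynomial $$b-\sum_{i=1}^{n} b_iX_i^p\qquad(*)$$ with $n\in\mathbb N$, $b,b_1,\dots,b_n\in K$, such that $b_1,\dots,b_n$ form a basis of a finite extension of $K^p$ inside $K$. (2) If $vK$ is divisible or a $\mathbb Z$-group, then $(K,v)$ is inseparably defectless if and only if it is $\mathcal O$-extremal with respect to every polynomial $(*)$ with $n\in\mathbb N$, $b,b_1,\dots,b_n\in\mathcal O$, such that $b_1,\dots,b_n$ form a valuation basis of a finite defectless extension of $K^p$ inside $K$ and $vb_1,\dots,vb_n$ are smaller than every positive element of $vK^p$. -/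

import Mathlib

/-!
Valuations are written multiplicatively, as in Mathlib, so the order is reversed with respect to the
additive notation: `∞` is `0`, "positive value" means "value `< 1`", a minimum of additive values is
a maximum of multiplicative ones and vice versa, and the value group `vK` is the subgroup
`MonoidWithZeroHom.valueGroup v` of `Γ₀ˣ` of the values of the nonzero elements of `K`.
-/

universe u

namespace DefectValuation

/-- The value group `vK` of `(K, v)`, as the subgroup of `Γ₀ˣ` of all values of nonzero elements. -/
def valueGroup {K Γ₀ : Type*} [Field K] [LinearOrderedCommGroupWithZero Γ₀]
    (v : Valuation K Γ₀) : Subgroup Γ₀ˣ :=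
  (Units.map (v : K →* Γ₀)).range

section Extensions

variable {K L Γ₀ Γ₁ : Type*} [Field K] [Field L] [Algebra K L]
  [LinearOrderedCommGroupWithZero Γ₀] [LinearOrderedCommGroupWithZero Γ₁]

/-- The ramification index `(wL : vK)` of an extension `w` to `L` of a valuation of `K`; the
value group of `K` is computed with the restriction of `w`. -/
noncomputable def ramificationIndex (K : Type*) {L Γ₁ : Type*} [Field K] [Field L] [Algebra K L]
    [LinearOrderedCommGroupWithZero Γ₁] (w : Valuation L Γ₁) : ℕ :=
  (valueGroup (w.comap (algebraMap K L))).relIndex (valueGroup w)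

/-- The inertia degree `[Lw : Kv]` of an extension `w` to `L` of the valuation `v` of `K`. -/
noncomputable def inertiaDegree (v : Valuation K Γ₀) (w : Valuation L Γ₁) [v.HasExtension w] : ℕ :=
  Module.finrank (IsLocalRing.ResidueField v.valuationSubring)
    (IsLocalRing.ResidueField w.valuationSubring)

/-- The finite extension `L` of the valued field `(K, v)` is defectless: equality holds in the
fundamental inequality `[L : K] ≥ ∑ eᵢ fᵢ`. The sum is over all extensions of `v` to `L` up to
equivalence, each represented by its valuation ring `W`. (The fundamental inequality makes this
index set and all `eᵢ`, `fᵢ` finite.) If the extension of `v` to `L` is unique, the condition is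
`[L : K] = (vL : vK) [Lv : Kv]`. -/
def IsDefectless (v : Valuation K Γ₀) (L : Type*) [Field L] [Algebra K L] : Prop :=
  FiniteDimensional K L ∧
    Module.finrank K L =
      ∑ᶠ W : {W : ValuationSubring L // v.HasExtension W.valuation},
        haveI := W.2
        ramificationIndex K W.1.valuation * inertiaDegree v W.1.valuation

end Extensions

/-- `(K, v)` is an inseparably defectless field: every finite purely inseparable extension of `K`
satisfies equality in the fundamental inequality. -/
def IsInseparablyDefectless {K : Type u} {Γ₀ : Type*} [Field K] [LinearOrderedCommGroupWithZero Γ₀]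
    (v : Valuation K Γ₀) : Prop :=
  ∀ (L : Type u) [Field L] [Algebra K L] [FiniteDimensional K L] [IsPurelyInseparable K L],
    IsDefectless v L

section Field

variable {K Γ₀ : Type*} [Field K] [LinearOrderedCommGroupWithZero Γ₀]

/-- The value group of `(K, v)` is divisible. -/
def HasDivisibleValueGroup (v : Valuation K Γ₀) : Prop :=
  ∀ n : ℕ, 0 < n → ∀ g ∈ valueGroup v, ∃ h ∈ valueGroup v, h ^ n = g

/-- The value group of `(K, v)` is a `ℤ`-group: it has a least positive element `a` (so `a` is the
largest element `< 1` in multiplicative notation), and its quotient by the subgroup generated by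
`a` is divisible. -/
def HasZGroupValueGroup (v : Valuation K Γ₀) : Prop :=
  ∃ a ∈ valueGroup v, a < 1 ∧ (∀ g ∈ valueGroup v, g < 1 → g ≤ a) ∧
    ∀ n : ℕ, 0 < n → ∀ g ∈ valueGroup v, ∃ h ∈ valueGroup v, ∃ k : ℤ, g = h ^ n * a ^ k

/-- `(K, v)` is `K`-extremal with respect to `f`: the set of the values of `f` at all points of
`K ^ n` has a maximum (a least element, in multiplicative notation). -/
def IsKExtremal (v : Valuation K Γ₀) {n : ℕ} (f : MvPolynomial (Fin n) K) : Prop :=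
  ∃ m, IsLeast {γ | ∃ x : Fin n → K, v (MvPolynomial.eval x f) = γ} m

/-- `(K, v)` is `𝒪`-extremal with respect to `f`: the set of the values of `f` at all points with
coordinates in the valuation ring has a maximum (a least element, in multiplicative notation). -/
def IsOExtremal (v : Valuation K Γ₀) {n : ℕ} (f : MvPolynomial (Fin n) K) : Prop :=
  ∃ m, IsLeast {γ | ∃ x : Fin n → K, (∀ i, x i ∈ v.valuationSubring) ∧
    v (MvPolynomial.eval x f) = γ} m

/-- The `p`-polynomial `b - ∑ bᵢ Xᵢ ^ p`. -/
noncomputable def pPolynomial (p : ℕ) {n : ℕ} (b : K) (c : Fin n → K) : MvPolynomial (Fin n) K :=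
  MvPolynomial.C b - ∑ i, MvPolynomial.C (c i) * MvPolynomial.X i ^ p

/-- A basis `B` of the extension `E` of the field `F`, valued by `w`, is a valuation basis:
`w (∑ cᵢ Bᵢ)` is the minimum (the greatest element, in multiplicative notation) of the values
`w (cᵢ Bᵢ)`, for all choices of the `cᵢ` in `F`. -/
def IsValuationBasis {F E Γ₁ : Type*} [Field F] [Field E] [Algebra F E]
    [LinearOrderedCommGroupWithZero Γ₁] (w : Valuation E Γ₁) {n : ℕ}
    (B : Module.Basis (Fin n) F E) : Prop :=
  ∀ c : Fin n → F, IsGreatest (Set.range fun i => w (c i • B i)) (w (∑ i, c i • B i))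

/-- The subfield `K ^ p` of `p`-th powers. -/
abbrev pPowers (K : Type*) [Field K] (p : ℕ) [ExpChar K p] : Subfield K :=
  (frobenius K p).fieldRange

/-- The restriction of the valuation `v` of `K` to `K ^ p`. -/
abbrev onPPowers (v : Valuation K Γ₀) (p : ℕ) [ExpChar K p] : Valuation (pPowers K p) Γ₀ :=
  v.comap (algebraMap (pPowers K p) K)

end Field

end DefectValuation

/-! Two translations carry the proof. A valuation extends uniquely to a finite purely inseparable
extension, which is defectless exactly when it has a valuation basis
(`isDefectless_iff_exists_valIndep`). And the elements `∑ bᵢ xᵢ ^ p` fill the extension `L` of `K ^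
p` with basis `bᵢ`, so `K`-extremality means that `b` has a best approximation in `L`
(`isKExtremal_pPolynomial_iff`).

If `K` is inseparably defectless, Frobenius identifies `K` with `K ^ p`, so `L(b)` has a valuation
basis over `K ^ p`. Elements of a space with a valuation basis have best approximations in each
subspace, by an orthogonal exchange argument (`ValIndep.exists_basis_and_approximation`).

Conversely, let `y` be a best approximation in `L` of some `b ∉ L`. Either the value of `b - y` is
new modulo `vL`, hence of order `p`, or a rescaling of `b - y` has a residue of degree `p` over that
of `L`; in both cases the powers of `b - y` are valuation independent over `L`
(`valIndep_pow_of_best`). Adjoining elements one by one, every finite subset of `K` lies in a finite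
extension of `K ^ p` with a valuation basis. Products in towers pass from `K ^ p` to `K ^ (p ^ n)`,
and `x ↦ x ^ (p ^ n)` embeds any finite purely inseparable extension into `K` as a subspace of such
a space.

In the second part, multiplication by `p`-th powers normalises `b` and the valuation basis. Then
only integral coordinates give integral combinations, and non-integral combinations never
approximate `b` better than `0` does. -/

namespace DefectValuation

/-! ### Valuation independence, orthogonal complements and best approximation. -/

section Independence

variable {F M E Γ ι κ : Type*} [Field F] [Field M] [Field E] [LinearOrderedCommGroupWithZero Γ]
  [Fintype ι] [Fintype κ]

/-- The `F`-linear combinations of a finite family of elements of `E`, where `F` acts on `E`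
through the ring homomorphism `φ`. -/
def combinations (φ : F →+* E) (x : ι → E) : AddSubgroup E where
  carrier := Set.range fun c : ι → F => ∑ j, φ (c j) * x j
  zero_mem' := ⟨0, by simp⟩
  add_mem' := by
    rintro _ _ ⟨c, rfl⟩ ⟨d, rfl⟩
    exact ⟨c + d, by simp [add_mul, Finset.sum_add_distrib]⟩
  neg_mem' := by
    rintro _ ⟨c, rfl⟩
    exact ⟨-c, by simp⟩

theorem sum_mem_combinations (φ : F →+* E) (x : ι → E) (c : ι → F) :
    ∑ j, φ (c j) * x j ∈ combinations φ x :=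
  ⟨c, rfl⟩

theorem mul_mem_combinations {φ : F →+* E} {x : ι → E} (a : F) {s : E}
    (hs : s ∈ combinations φ x) : φ a * s ∈ combinations φ x := by
  obtain ⟨c, rfl⟩ := hs
  exact ⟨fun j => a * c j, by simp [Finset.mul_sum, mul_assoc]⟩

theorem self_mem_combinations [DecidableEq ι] (φ : F →+* E) (x : ι → E) (i : ι) :
    x i ∈ combinations φ x :=
  ⟨Pi.single i 1, by simp [Pi.single_apply]⟩

theorem combinations_subset {φ : F →+* E} {x : ι → E} {V : AddSubgroup E}
    (hV : ∀ a, ∀ s ∈ V, φ a * s ∈ V) (hx : ∀ i, x i ∈ V) : combinations φ x ≤ V := by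
  rintro _ ⟨c, rfl⟩
  exact V.sum_mem fun j _ => hV _ _ (hx j)

/-- A finite family of nonzero elements of `E` is valuation independent over `F` if the value of
every linear combination is the minimum of the values of its terms. -/
def ValIndep (φ : F →+* E) (w : Valuation E Γ) (x : ι → E) : Prop :=
  (∀ i, x i ≠ 0) ∧ ∀ (c : ι → F) (i : ι), w (φ (c i) * x i) ≤ w (∑ j, φ (c j) * x j)

theorem combinations_comp_equiv (φ : F →+* E) (x : ι → E) (e : κ ≃ ι) :
    combinations φ (x ∘ e) = combinations φ x := by
  ext s
  constructor
  · rintro ⟨c, rfl⟩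
    exact ⟨c ∘ e.symm, by simp [← e.sum_comp]⟩
  · rintro ⟨c, rfl⟩
    exact ⟨c ∘ e, by simp [← e.sum_comp]⟩

theorem ValIndep.comp_equiv {φ : F →+* E} {w : Valuation E Γ} {x : ι → E} (hx : ValIndep φ w x)
    (e : κ ≃ ι) : ValIndep φ w (x ∘ e) := by
  refine ⟨fun i => hx.1 _, fun c i => ?_⟩
  simpa [← e.sum_comp] using hx.2 (c ∘ e.symm) (e i)

theorem ValIndep.comp_succAbove {φ : F →+* E} {w : Valuation E Γ} {n : ℕ} {x : Fin (n + 1) → E}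
    (hx : ValIndep φ w x) (i : Fin (n + 1)) : ValIndep φ w (x ∘ i.succAbove) := by
  refine ⟨fun j => hx.1 _, fun c j => ?_⟩
  simpa [Fin.sum_univ_succAbove _ i] using hx.2 (i.insertNth 0 c) (i.succAbove j)

theorem ValIndep.of_isEquiv {Γ' : Type*} [LinearOrderedCommGroupWithZero Γ'] {φ : F →+* E}
    {w : Valuation E Γ} {w' : Valuation E Γ'} (h : w.IsEquiv w') {x : ι → E}
    (hx : ValIndep φ w x) : ValIndep φ w' x :=
  ⟨hx.1, fun c i => (h _ _).1 (hx.2 c i)⟩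

theorem ValIndep.linearIndependent [Algebra F E] {w : Valuation E Γ} {x : ι → E}
    (hx : ValIndep (algebraMap F E) w x) : LinearIndependent F x := by
  rw [Fintype.linearIndependent_iff]
  intro c hc i
  have h := hx.2 c i
  simp only [← Algebra.smul_def, hc, map_zero, le_zero_iff, map_eq_zero, smul_eq_zero] at h
  exact h.resolve_right (hx.1 i)

/-- If `w u ≤ w (u + s)` for all `s` in a subspace, then the line of `u` is orthogonal to the
subspace. -/
theorem orthogonal_line {φ : F →+* E} {w : Valuation E Γ} {V : AddSubgroup E}
    (hV : ∀ a, ∀ s ∈ V, φ a * s ∈ V) {u : E} (hu : ∀ s ∈ V, w u ≤ w (u + s)) (a : F) {s : E}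
    (hs : s ∈ V) : w (φ a * u) ≤ w (φ a * u + s) ∧ w s ≤ w (φ a * u + s) := by
  have h : w (φ a * u) ≤ w (φ a * u + s) := by
    rcases eq_or_ne a 0 with rfl | ha
    · simp
    · have ha' : φ a ≠ 0 := by simpa using ha
      have : φ a * u + s = φ a * (u + φ a⁻¹ * s) := by
        rw [map_inv₀]; field_simp
      rw [this, map_mul, map_mul]
      exact mul_le_mul_right (hu _ (hV _ _ hs)) _
  refine ⟨h, ?_⟩
  calc w s = w ((φ a * u + s) - φ a * u) := by ring_nf
    _ ≤ max (w (φ a * u + s)) (w (φ a * u)) := w.map_sub _ _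
    _ = _ := max_eq_left h

theorem ValIndep.cons {φ : F →+* E} {w : Valuation E Γ} {n : ℕ} {y : Fin n → E}
    (hy : ValIndep φ w y) {u : E} (hu0 : u ≠ 0)
    (hu : ∀ s ∈ combinations φ y, w u ≤ w (u + s)) :
    ValIndep φ w (Fin.cons u y : Fin (n + 1) → E) := by
  refine ⟨fun i => ?_, fun c i => ?_⟩
  · refine Fin.cases ?_ (fun j => ?_) i
    · simpa using hu0
    · simpa using hy.1 j
  · have h := orthogonal_line (fun a s => mul_mem_combinations a) hu (c 0)
      (sum_mem_combinations φ y (fun j => c j.succ))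
    rw [Fin.sum_univ_succ]
    simp only [Fin.cons_zero, Fin.cons_succ]
    refine Fin.cases ?_ (fun j => ?_) i
    · simpa using h.1
    · simpa using (hy.2 (fun j => c j.succ) j).trans h.2

theorem mem_combinations_cons {φ : F →+* E} {n : ℕ} {y : Fin n → E} {u s : E} :
    s ∈ combinations φ (Fin.cons u y : Fin (n + 1) → E) ↔
      ∃ a, ∃ t ∈ combinations φ y, φ a * u + t = s := by
  constructor
  · rintro ⟨c, rfl⟩
    exact ⟨c 0, _, sum_mem_combinations φ y (fun j => c j.succ), by simp [Fin.sum_univ_succ]⟩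
  · rintro ⟨a, _, ⟨c, rfl⟩, rfl⟩
    exact ⟨Fin.cons a c, by simp [Fin.sum_univ_succ]⟩

/-- A nonzero combination of a valuation independent family can replace one of its members. -/
theorem ValIndep.exists_exchange {φ : F →+* E} {w : Valuation E Γ} {n : ℕ} {x : Fin (n + 1) → E}
    (hx : ValIndep φ w x) {u : E} (hu : u ∈ combinations φ x) :
    ∃ i : Fin (n + 1), (∀ s ∈ combinations φ (x ∘ i.succAbove), w u ≤ w (u + s)) ∧
      (u ≠ 0 → ∀ s ∈ combinations φ x,
        ∃ a, ∃ t ∈ combinations φ (x ∘ i.succAbove), φ a * u + t = s) := by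
  obtain ⟨c, rfl⟩ := hu
  -- The member to be replaced is the one carrying a dominant term of `u`: adding combinations of
  -- the others leaves this term in place, so the value cannot drop below that of `u`.
  obtain ⟨i, -, hi⟩ := Finset.exists_max_image Finset.univ (fun j => w (φ (c j) * x j)) ⟨0, by simp⟩
  have hle : w (∑ j, φ (c j) * x j) ≤ w (φ (c i) * x i) := w.map_sum_le hi
  refine ⟨i, ?_, fun hu s hs => ?_⟩
  · rintro _ ⟨d, rfl⟩
    refine hle.trans ?_
    have := hx.2 (i.insertNth (c i) (fun j => c (i.succAbove j) + d j)) i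
    simpa [Fin.sum_univ_succAbove _ i, add_mul, Finset.sum_add_distrib, add_assoc] using this
  · have hci : c i ≠ 0 := by
      rintro h0
      rw [h0, map_zero, zero_mul, map_zero, le_zero_iff, map_eq_zero] at hle
      exact hu hle
    have hci' : φ (c i) ≠ 0 := by simpa using hci
    obtain ⟨d, rfl⟩ := hs
    refine ⟨d i / c i, _, sum_mem_combinations _ _
      (fun j => d (i.succAbove j) - d i / c i * c (i.succAbove j)), ?_⟩
    simp only [Fin.sum_univ_succAbove _ i, map_sub, map_mul, map_div₀, sub_mul,
      Finset.sum_sub_distrib, Function.comp_apply, mul_add, Finset.mul_sum]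
    field_simp
    ring

/-- A subspace of a space with a valuation basis has a valuation basis, and every element of the
larger space has a best approximation in it. -/
theorem ValIndep.exists_basis_and_approximation {φ : F →+* E} {w : Valuation E Γ} {n : ℕ}
    {x : Fin n → E} (hx : ValIndep φ w x) {V : AddSubgroup E}
    (hV : ∀ a, ∀ s ∈ V, φ a * s ∈ V) (hVx : V ≤ combinations φ x) :
    (∃ (m : ℕ) (y : Fin m → E), ValIndep φ w y ∧ combinations φ y = V) ∧
      ∀ b ∈ combinations φ x, ∃ y ∈ V, ∀ z ∈ V, w (b - y) ≤ w (b - z) := by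
  induction n generalizing V with
  | zero =>
    have hV0 : V = combinations φ x := by
      refine le_antisymm hVx ?_
      rintro _ ⟨c, rfl⟩
      simp
    refine ⟨⟨0, x, hx, hV0.symm⟩, fun b hb => ⟨b, hV0 ▸ hb, fun z _ => by simp⟩⟩
  | succ n ih =>
    by_cases hV0 : ∀ u ∈ V, u = 0
    · have hV0' : V = ⊥ := (AddSubgroup.eq_bot_iff_forall V).2 hV0
      refine ⟨⟨0, Fin.elim0, ⟨fun i => i.elim0, fun _ i => i.elim0⟩, ?_⟩,
        fun b _ => ⟨0, V.zero_mem, fun z hz => by rw [hV0 z hz]⟩⟩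
      rw [hV0', AddSubgroup.eq_bot_iff_forall]
      rintro _ ⟨c, rfl⟩
      simp
    · push Not at hV0
      obtain ⟨u, huV, hu0⟩ := hV0
      -- The whole space is the orthogonal sum of the line of `u` and the span of the other `n`
      -- members. As `u` lies in `V`, so does `V` split, and induction applies to the second
      -- summand.
      obtain ⟨i, horth, hdec⟩ := hx.exists_exchange (hVx huV)
      specialize hdec hu0
      obtain ⟨⟨m, y, hy, hyV⟩, happ⟩ := ih (V := V ⊓ combinations φ (x ∘ i.succAbove))
        (hx.comp_succAbove i) (fun a s hs => ⟨hV a s hs.1, mul_mem_combinations a hs.2⟩)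
        inf_le_right
      have hort := fun a s hs => orthogonal_line (s := s) (V := combinations φ (x ∘ i.succAbove))
        (fun a s => mul_mem_combinations a) horth a hs
      refine ⟨⟨m + 1, Fin.cons u y, hy.cons hu0 fun s hs => ?_, ?_⟩, fun b hb => ?_⟩
      · rw [hyV] at hs
        exact horth s hs.2
      · ext s
        rw [mem_combinations_cons, hyV]
        constructor
        · rintro ⟨a, t, ht, rfl⟩
          exact V.add_mem (hV _ _ huV) ht.1
        · intro hs
          obtain ⟨a, t, ht, rfl⟩ := hdec s (hVx hs)
          refine ⟨a, t, ⟨?_, ht⟩, rfl⟩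
          simpa using V.sub_mem hs (hV a _ huV)
      · obtain ⟨a, b', hb', rfl⟩ := hdec b hb
        obtain ⟨y', hy', hbest⟩ := happ b' hb'
        refine ⟨φ a * u + y', V.add_mem (hV _ _ huV) hy'.1, fun z hz => ?_⟩
        obtain ⟨d, t, ht, rfl⟩ := hdec z (hVx hz)
        have htV : t ∈ V := by simpa using V.sub_mem hz (hV d _ huV)
        have h1 := hbest t ⟨htV, ht⟩
        -- By orthogonality, discarding the component along `u` cannot increase the multiplicative
        -- value; only the approximation of `b'` matters.
        have h2 := (hort (a - d) (b' - t) (AddSubgroup.sub_mem _ hb' ht)).2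
        calc w (φ a * u + b' - (φ a * u + y')) = w (b' - y') := by ring_nf
          _ ≤ _ := h1.trans h2
          _ = _ := by rw [map_sub]; ring_nf

/-- Products of valuation independent families in a tower are valuation independent. -/
theorem ValIndep.tower {φ : F →+* M} {ψ : M →+* E} {w : Valuation E Γ} {x : ι → M} {y : κ → E}
    (hx : ValIndep φ (w.comap ψ) x) (hy : ValIndep ψ w y) :
    ValIndep (ψ.comp φ) w fun k : κ × ι => ψ (x k.2) * y k.1 := by
  refine ⟨fun k => mul_ne_zero (by simpa using hx.1 k.2) (hy.1 k.1), fun c k => ?_⟩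
  have h1 := hy.2 (fun k => ∑ j, φ (c (k, j)) * x j) k.1
  have h2 := mul_le_mul_left (hx.2 (fun j => c (k.1, j)) k.2) (w (y k.1))
  simp only [Valuation.comap_apply, ← map_mul] at h2
  convert h2.trans h1 using 2
  · simp [mul_assoc]
  · simp [Fintype.sum_prod_type, Finset.sum_mul, mul_assoc]

theorem mem_combinations_tower {φ : F →+* M} {ψ : M →+* E} {x : ι → M} {y : κ → E} {c : κ → M}
    (hc : ∀ k, c k ∈ combinations φ x) :
    ∑ k, ψ (c k) * y k ∈ combinations (ψ.comp φ) fun k : κ × ι => ψ (x k.2) * y k.1 := by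
  choose d hd using hc
  refine ⟨fun k => d k.1 k.2, ?_⟩
  simp only [Fintype.sum_prod_type, ← hd, map_sum, map_mul, Finset.sum_mul, RingHom.comp_apply,
    mul_assoc]

/-- A finite sum whose nonzero terms have distinct values has the value of its dominant term. -/
theorem le_map_sum_of_ne (w : Valuation E Γ) (a : ι → E)
    (ha : ∀ i j, i ≠ j → a i ≠ 0 → w (a i) ≠ w (a j)) (i : ι) : w (a i) ≤ w (∑ j, a j) := by
  classical
  obtain ⟨k, -, hk⟩ := Finset.exists_max_image Finset.univ (fun j => w (a j)) ⟨i, by simp⟩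
  by_cases h0 : a k = 0
  · have := hk i (by simp)
    rw [h0, map_zero] at this
    exact this.trans zero_le
  · refine (hk i (by simp)).trans (le_of_eq ?_)
    refine (w.map_sum_eq_of_lt (Finset.mem_univ k) fun j hj => ?_).symm
    have hjk : k ≠ j := by simpa [eq_comm] using hj
    exact lt_of_le_of_ne (hk j (by simp)) (ha k j hjk h0).symm

end Independence

/-! ### Valuation bases and the equality `[E : F] = e f`. -/

section Ramification

open IsLocalRing

variable {F E Γ₀ Γ₁ ι κ : Type*} [Field F] [Field E] [Algebra F E]
  [LinearOrderedCommGroupWithZero Γ₀] [LinearOrderedCommGroupWithZero Γ₁]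
  [Fintype ι] [Fintype κ]

theorem residue_eq_zero_iff_lt_one (v : Valuation F Γ₀) (a : v.valuationSubring) :
    residue v.valuationSubring a = 0 ↔ v a < 1 := by
  rw [residue_eq_zero_iff, Valuation.mem_maximalIdeal_iff]

variable (F) in
/-- The coset of the value of a nonzero element of `E` modulo the value group of `F`. -/
def valueCoset (w : Valuation E Γ₁) : Eˣ →*
    valueGroup w ⧸ (valueGroup (w.comap (algebraMap F E))).subgroupOf (valueGroup w) :=
  (QuotientGroup.mk' _).comp (Units.map (w : E →* Γ₁)).rangeRestrict

theorem valueCoset_surjective (w : Valuation E Γ₁) : Function.Surjective (valueCoset F w) :=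
  (QuotientGroup.mk'_surjective _).comp (MonoidHom.rangeRestrict_surjective _)

theorem valueCoset_eq_iff (w : Valuation E Γ₁) (x y : Eˣ) :
    valueCoset F w x = valueCoset F w y ↔ ∃ a : F, w x = w (algebraMap F E a * y) := by
  rw [eq_comm, ← inv_mul_eq_one, ← map_inv, ← map_mul]
  change (QuotientGroup.mk _ : valueGroup w ⧸ _) = 1 ↔ _
  rw [QuotientGroup.eq_one_iff, Subgroup.mem_subgroupOf]
  constructor
  · rintro ⟨a, ha⟩
    refine ⟨a, ?_⟩
    have h : w (algebraMap F E a) = w ((y⁻¹ * x : Eˣ) : E) := congrArg Units.val ha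
    rw [Units.val_mul, map_mul, Units.val_inv_eq_inv_val, map_inv₀] at h
    have hy : w y ≠ 0 := by simp
    rw [map_mul, h]
    field_simp
  · rintro ⟨a, ha⟩
    have ha0 : a ≠ 0 := by
      rintro rfl
      simp at ha
    refine ⟨Units.mk0 a ha0, Units.ext ?_⟩
    have hy : w y ≠ 0 := by simp
    change w (algebraMap F E a) = w ((y⁻¹ * x : Eˣ) : E)
    rw [Units.val_mul, map_mul, ha, map_mul, Units.val_inv_eq_inv_val, map_inv₀]
    field_simp

theorem ramificationIndex_eq_card (w : Valuation E Γ₁) : ramificationIndex F w =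
    Nat.card (valueGroup w ⧸ (valueGroup (w.comap (algebraMap F E))).subgroupOf (valueGroup w)) :=
  rfl

variable (v : Valuation F Γ₀) (w : Valuation E Γ₁) [v.HasExtension w]

theorem residue_sum_smul (d : ι → v.valuationSubring) (y : ι → w.valuationSubring) :
    ∑ j, residue v.valuationSubring (d j) • residue w.valuationSubring (y j) =
      residue w.valuationSubring (∑ j, algebraMap v.valuationSubring w.valuationSubring (d j) *
        y j) := by
  simp only [map_sum, map_mul, Algebra.smul_def,
    Valuation.HasExtension.algebraMap_residue_eq_residue_algebraMap]

theorem coe_sum_algebraMap_mul (d : ι → v.valuationSubring) (y : ι → w.valuationSubring) :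
    ((∑ j, algebraMap v.valuationSubring w.valuationSubring (d j) * y j : w.valuationSubring) : E) =
      ∑ j, algebraMap F E (d j) * y j :=
  map_sum w.valuationSubring.subtype _ _

/-- Integral elements with linearly independent residues are valuation independent, and all their
values are trivial. -/
theorem map_le_map_sum_of_residue {y : ι → w.valuationSubring}
    (hy : LinearIndependent (ResidueField v.valuationSubring)
      fun i => residue w.valuationSubring (y i)) (c : ι → F) (i : ι) :
    w (algebraMap F E (c i)) ≤ w (∑ j, algebraMap F E (c j) * y j) := by
  obtain ⟨k, -, hk⟩ := Finset.exists_max_image Finset.univ (fun j => v (c j)) ⟨i, by simp⟩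
  have hi : w (algebraMap F E (c i)) ≤ w (algebraMap F E (c k)) :=
    (Valuation.HasExtension.val_map_le_iff v w _ _).2 (hk i (by simp))
  refine hi.trans (not_lt.1 fun hlt => ?_)
  have hk0 : c k ≠ 0 := by
    intro h
    simp [h] at hlt
  -- Dividing by the dominant coefficient makes all coefficients integral and the `k`-th one equal
  -- to `1`, so a drop in value would be a nontrivial relation between the residues.
  have hd : ∀ j, c j / c k ∈ v.valuationSubring := fun j => by
    rw [Valuation.mem_valuationSubring_iff, map_div₀]
    exact div_le_one_of_le₀ (hk j (by simp)) zero_le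
  have hsum := residue_sum_smul v w (fun j => ⟨c j / c k, hd j⟩) y
  have hz : residue w.valuationSubring (∑ j, algebraMap v.valuationSubring w.valuationSubring
      ⟨c j / c k, hd j⟩ * y j) = 0 := by
    rw [residue_eq_zero_iff_lt_one]
    have hE : ((∑ j, algebraMap v.valuationSubring w.valuationSubring ⟨c j / c k, hd j⟩ * y j :
        w.valuationSubring) : E) = (algebraMap F E (c k))⁻¹ * ∑ j, algebraMap F E (c j) * y j := by
      rw [coe_sum_algebraMap_mul]
      simp only [map_div₀, Finset.mul_sum]
      refine Finset.sum_congr rfl fun j _ => ?_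
      ring
    rw [hE, map_mul, map_inv₀]
    have h0 : 0 < w (algebraMap F E (c k)) := by
      rw [zero_lt_iff]; simpa using hk0
    exact (inv_mul_lt_iff₀ h0).2 (by rwa [mul_one])
  rw [hz] at hsum
  have h1 := Fintype.linearIndependent_iff.1 hy _ hsum k
  rw [residue_eq_zero_iff_lt_one] at h1
  simp [div_self hk0] at h1

/-- Products of representatives of distinct value cosets with lifts of linearly independent
residues are valuation independent. -/
theorem valIndep_of_coset_of_residue {y : ι → w.valuationSubring} {g : κ → Eˣ}
    (hy : LinearIndependent (ResidueField v.valuationSubring)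
      fun i => residue w.valuationSubring (y i))
    (hg : Function.Injective fun k => valueCoset F w (g k)) :
    ValIndep (algebraMap F E) w fun k : κ × ι => (y k.2 : E) * g k.1 := by
  classical
  have hy0 : ∀ i, (y i : E) ≠ 0 := fun i h => hy.ne_zero i (by
    have : y i = 0 := Subtype.ext h
    simp [this])
  refine ⟨fun k => mul_ne_zero (hy0 _) (g k.1).ne_zero, fun c k => ?_⟩
  set u : κ → E := fun k => ∑ j, algebraMap F E (c (k, j)) * y j with hu
  have hle : ∀ k j, w (algebraMap F E (c (k, j))) ≤ w (u k) := fun k j =>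
    map_le_map_sum_of_residue v w hy (fun j => c (k, j)) j
  have hyle : ∀ k j, w (algebraMap F E (c (k, j)) * y j) ≤ w (algebraMap F E (c (k, j))) := by
    intro k j
    rw [map_mul]
    exact mul_le_of_le_one_right' (y j).2
  -- Each inner sum has its value in the value group of `F`, so nonzero terms `u k * g k` lie in
  -- distinct cosets and cannot cancel.
  have hval : ∀ k, u k ≠ 0 → ∃ a : F, w (u k) = w (algebraMap F E a) := by
    intro k hk
    have hne : (Finset.univ : Finset ι).Nonempty := by
      by_contra h
      rw [Finset.not_nonempty_iff_eq_empty] at h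
      exact hk (by simp [hu, h])
    obtain ⟨m, -, hm⟩ := Finset.exists_max_image Finset.univ
      (fun j => w (algebraMap F E (c (k, j)))) hne
    exact ⟨c (k, m), le_antisymm
      (w.map_sum_le fun j hj => (hyle k j).trans (hm j hj)) (hle k m)⟩
  have hsum : ∑ j, algebraMap F E (c j) * ((y j.2 : E) * g j.1) = ∑ k, u k * g k := by
    simp only [Fintype.sum_prod_type, hu, Finset.sum_mul, mul_assoc]
  rw [hsum]
  refine le_trans ?_ (le_map_sum_of_ne w (fun k => u k * g k) ?_ k.1)
  · rw [← mul_assoc, map_mul]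
    rw [map_mul w (u k.1)]
    exact mul_le_mul_left ((hyle k.1 k.2).trans (hle k.1 k.2)) _
  · intro k l hkl hk0 h
    have hk : u k ≠ 0 := left_ne_zero_of_mul hk0
    have hl : u l ≠ 0 := by
      intro h0
      rw [h0, zero_mul, map_zero, map_eq_zero] at h
      exact hk0 h
    obtain ⟨a, ha⟩ := hval k hk
    obtain ⟨b, hb⟩ := hval l hl
    refine hkl (hg ((valueCoset_eq_iff w _ _).2 ⟨b / a, ?_⟩))
    have ha0 : w (algebraMap F E a) ≠ 0 := by
      rw [← ha]; simpa using hk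
    rw [map_mul, map_mul, ha, hb] at h
    rw [map_mul, map_div₀, map_div₀, div_mul_eq_mul_div, eq_div_iff ha0, mul_comm, h]

/-- Members of a valuation independent family with the same value coset give, after scaling,
linearly independent residues. -/
theorem ValIndep.card_le_inertiaDegree [Module.Finite (ResidueField v.valuationSubring)
    (ResidueField w.valuationSubring)] {z : ι → E} (hz : ValIndep (algebraMap F E) w z) {g : E}
    (hg : g ≠ 0) (a : ι → F) (ha : ∀ i, w (algebraMap F E (a i) * z i) = w g) :
    Fintype.card ι ≤ inertiaDegree v w := by
  have hg' : w g ≠ 0 := by simpa using hg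
  have hone : ∀ i, w (algebraMap F E (a i) * z i / g) = 1 := fun i => by
    rw [map_div₀, ha, div_self hg']
  set y : ι → w.valuationSubring := fun i => ⟨algebraMap F E (a i) * z i / g, (hone i).le⟩ with hy
  have hli : LinearIndependent (ResidueField v.valuationSubring)
      fun i => residue w.valuationSubring (y i) := by
    rw [Fintype.linearIndependent_iff]
    intro c hc i
    choose d hd using fun j => residue_surjective (R := v.valuationSubring) (c j)
    obtain rfl : c = fun j => residue v.valuationSubring (d j) := funext fun j => (hd j).symm
    rw [residue_sum_smul, residue_eq_zero_iff_lt_one] at hc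
    rw [residue_eq_zero_iff_lt_one, ← Valuation.HasExtension.val_map_lt_one_iff v w]
    have h := hz.2 (fun j => (d j : F) * a j) i
    have h1 : (algebraMap F E (d i * a i)) * z i = algebraMap F E (d i) * (y i : E) * g := by
      rw [hy, map_mul]; field_simp
    have h2 : ∑ j, algebraMap F E (d j * a j) * z j =
        ((∑ j, algebraMap v.valuationSubring w.valuationSubring (d j) * y j :
          w.valuationSubring) : E) * g := by
      rw [coe_sum_algebraMap_mul, Finset.sum_mul]
      refine Finset.sum_congr rfl fun j _ => ?_
      rw [hy, map_mul]
      field_simp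
    rw [h1, h2, map_mul, map_mul, map_mul, hone i, mul_one] at h
    exact (le_of_mul_le_mul_right h (zero_lt_iff.2 hg')).trans_lt hc
  exact hli.fintype_card_le_finrank

/-- Sort the basis by value cosets. Each class has at most `f` members, because rescaled members
have independent residues, so `n ≤ e f`. The reverse inequality comes from the independence of the
`e f` products of coset representatives and residue lifts. -/
theorem ValIndep.finrank_eq {z : ι → E} (hz : ValIndep (algebraMap F E) w z)
    (hspan : ∀ s, s ∈ combinations (algebraMap F E) z) :
    Module.finrank F E = Fintype.card ι ∧
      Module.finrank F E = ramificationIndex F w * inertiaDegree v w := by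
  classical
  have hcard : Module.finrank F E = Fintype.card ι := by
    refine Module.finrank_eq_card_basis (Module.Basis.mk hz.linearIndependent fun s _ => ?_)
    obtain ⟨c, rfl⟩ := hspan s
    refine Submodule.sum_mem _ fun j _ => ?_
    rw [← Algebra.smul_def]
    exact Submodule.smul_mem _ _ (Submodule.subset_span ⟨j, rfl⟩)
  refine ⟨hcard, ?_⟩
  have hfin : Module.Finite F E := by
    have : Nonempty ι := by
      by_contra h
      rw [not_nonempty_iff] at h
      obtain ⟨c, hc⟩ := hspan 1
      simp at hc
    exact Module.finite_of_finrank_pos (hcard ▸ Fintype.card_pos)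
  set q : ι → _ := fun i => valueCoset F w (Units.mk0 (z i) (hz.1 i)) with hq
  -- Every element of `E` has the value of one of the terms of its expansion, so every coset is met
  -- and `e` is finite.
  have hqs : Function.Surjective q := by
    intro γ
    obtain ⟨x, rfl⟩ := valueCoset_surjective w γ
    obtain ⟨c, hc⟩ := hspan x
    have hne : (Finset.univ : Finset ι).Nonempty := by
      by_contra h
      rw [Finset.not_nonempty_iff_eq_empty] at h
      simp only [h, Finset.sum_empty] at hc
      exact x.ne_zero hc.symm
    obtain ⟨m, -, hm⟩ := Finset.exists_max_image Finset.univ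
      (fun j => w (algebraMap F E (c j) * z j)) hne
    refine ⟨m, ((valueCoset_eq_iff w _ _).2 ⟨c m, ?_⟩).symm⟩
    rw [← hc]
    exact le_antisymm (w.map_sum_le hm) (hz.2 c m)
  have hQ : Finite (valueGroup w ⧸
    (valueGroup (w.comap (algebraMap F E))).subgroupOf (valueGroup w)) := Finite.of_surjective q hqs
  -- Lifts of independent residues are linearly independent over `F`; this bounds the residue degree
  -- and rules out the default value `0` of `finrank`.
  have hres : Module.Finite (ResidueField v.valuationSubring)
      (ResidueField w.valuationSubring) := by
    rw [← Module.rank_lt_aleph0_iff]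
    refine lt_of_le_of_lt (rank_le (n := Module.finrank F E) fun s hs => ?_)
      (Cardinal.natCast_lt_aleph0)
    choose y hy using fun i : s => residue_surjective (R := w.valuationSubring) (i : _)
    have := (valIndep_of_coset_of_residue v w (y := y) (g := fun _ : Unit => 1)
      (by simpa only [hy] using hs) (Function.injective_of_subsingleton _)).linearIndependent
    simpa using this.fintype_card_le_finrank
  have := Fintype.ofFinite (valueGroup w ⧸
    (valueGroup (w.comap (algebraMap F E))).subgroupOf (valueGroup w))
  rw [ramificationIndex_eq_card, Nat.card_eq_fintype_card]
  refine le_antisymm ?_ ?_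
  · rw [hcard, mul_comm]
    refine Finset.card_le_mul_card_image_of_maps_to (f := q) (s := Finset.univ)
      (t := Finset.univ) (fun _ _ => Finset.mem_univ _) _ fun γ _ => ?_
    obtain ⟨k, rfl⟩ := hqs γ
    have hfib : ∀ i : {i // i ∈ Finset.univ.filter fun i => q i = q k},
        ∃ a : F, w (z k) = w (algebraMap F E a * z i) := fun i =>
      (valueCoset_eq_iff w _ _).1 (Finset.mem_filter.1 i.2).2.symm
    choose a ha using hfib
    rw [← Fintype.card_coe]
    refine ValIndep.card_le_inertiaDegree v w (z := fun i : {i // i ∈ Finset.univ.filter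
      fun i => q i = q k} => z i) ⟨fun i => hz.1 _, fun c i => ?_⟩ (hz.1 k) a fun i => (ha i).symm
    -- The subfamily inherits independence by extending coefficients by `0` outside the fibre.
    have := hz.2 (fun j => if h : j ∈ Finset.univ.filter (fun i => q i = q k) then c ⟨j, h⟩ else 0) i
    rw [dif_pos i.2] at this
    refine this.trans (le_of_eq (congrArg w ?_))
    rw [← Finset.sum_subset (Finset.subset_univ (Finset.univ.filter fun i => q i = q k)),
      ← Finset.sum_coe_sort]
    · exact Finset.sum_congr rfl fun j _ => by rw [dif_pos j.2]
    · intro j _ hj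
      rw [dif_neg hj, map_zero, zero_mul]
  · choose g hg using valueCoset_surjective (F := F) w
    choose y hy using fun i => residue_surjective (R := w.valuationSubring)
      (Module.finBasis (ResidueField v.valuationSubring) (ResidueField w.valuationSubring) i)
    have := (valIndep_of_coset_of_residue v w (y := y) (g := g)
      (by simpa only [hy] using Module.Basis.linearIndependent _)
      (fun γ δ h => by simpa only [hg] using h)).linearIndependent
    simpa [inertiaDegree] using this.fintype_card_le_finrank

/-- The products of coset representatives and lifts of a residue basis are valuation independent; by
hypothesis there are `[E : F]` of them, so they span. -/
theorem exists_valIndep_of_finrank_eq [FiniteDimensional F E]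
    (h : Module.finrank F E = ramificationIndex F w * inertiaDegree v w) :
    ∃ z : Fin (Module.finrank F E) → E, ValIndep (algebraMap F E) w z ∧
      ∀ s, s ∈ combinations (algebraMap F E) z := by
  have hpos : 0 < Module.finrank F E := Module.finrank_pos
  -- Infinite index and infinite residue degree are both encoded as `0`; nonvanishing therefore
  -- gives finiteness.
  have he : ramificationIndex F w ≠ 0 := fun h0 => by simp [h0] at h; omega
  have hf : inertiaDegree v w ≠ 0 := fun h0 => by simp [h0] at h; omega
  rw [ramificationIndex_eq_card] at he h
  have hQ := (Nat.card_ne_zero.1 he).2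
  have := Fintype.ofFinite (valueGroup w ⧸
    (valueGroup (w.comap (algebraMap F E))).subgroupOf (valueGroup w))
  have hres : Module.Finite (ResidueField v.valuationSubring)
      (ResidueField w.valuationSubring) := Module.finite_of_finrank_pos (Nat.pos_of_ne_zero hf)
  choose g hg using valueCoset_surjective (F := F) w
  choose y hy using fun i => residue_surjective (R := w.valuationSubring)
    (Module.finBasis (ResidueField v.valuationSubring) (ResidueField w.valuationSubring) i)
  have hind := valIndep_of_coset_of_residue v w (y := y) (g := g)
    (by simpa only [hy] using Module.Basis.linearIndependent _)
    (fun γ δ h => by simpa only [hg] using h)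
  have e : Fin (Module.finrank F E) ≃ _ := (Fintype.equivFinOfCardEq
    (α := (valueGroup w ⧸ (valueGroup (w.comap (algebraMap F E))).subgroupOf (valueGroup w)) ×
      Fin (Module.finrank (ResidueField v.valuationSubring) (ResidueField w.valuationSubring)))
    (by rw [Fintype.card_prod, Fintype.card_fin, h, Nat.card_eq_fintype_card]; rfl)).symm
  have hind' := hind.comp_equiv e
  refine ⟨_, hind', fun s => ?_⟩
  have : Nonempty (Fin (Module.finrank F E)) := ⟨⟨0, hpos⟩⟩
  have htop := hind'.linearIndependent.span_eq_top_of_card_eq_finrank (by simp)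
  obtain ⟨c, hc⟩ := (Submodule.mem_span_range_iff_exists_fun F).1 (htop ▸ Submodule.mem_top (x := s))
  exact ⟨c, by simpa only [Algebra.smul_def] using hc⟩

end Ramification

/-! ### Purely inseparable extensions: uniqueness of the extended valuation, and defectlessness. -/

section PurelyInseparable

variable {F E Γ₀ Γ₁ : Type*} [Field F] [Field E] [Algebra F E]
  [LinearOrderedCommGroupWithZero Γ₀] [LinearOrderedCommGroupWithZero Γ₁]

/-- A valuation extends uniquely to a purely inseparable extension. -/
theorem isEquiv_of_hasExtension [IsPurelyInseparable F E] {Γ₂ : Type*}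
    [LinearOrderedCommGroupWithZero Γ₂] (v : Valuation F Γ₀) (w : Valuation E Γ₁)
    (w' : Valuation E Γ₂) [v.HasExtension w] [v.HasExtension w'] : w.IsEquiv w' := by
  rw [Valuation.isEquiv_iff_val_le_one]
  intro x
  -- Some power of `x` lies in `F`, and `x` is integral exactly when that power is.
  obtain ⟨n, y, hy⟩ := IsPurelyInseparable.pow_mem F (ringExpChar F) x
  have hq : ringExpChar F ^ n ≠ 0 := (expChar_pow_pos F _ n).ne'
  rw [← pow_le_one_iff (x := w x) hq, ← pow_le_one_iff (x := w' x) hq, ← map_pow, ← map_pow, ← hy,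
    Valuation.HasExtension.val_map_le_one_iff v w, Valuation.HasExtension.val_map_le_one_iff v w']

theorem hasExtension_valuationSubring (v : Valuation F Γ₀) (w : Valuation E Γ₁)
    [h : v.HasExtension w] : v.HasExtension w.valuationSubring.valuation :=
  ⟨h.val_isEquiv_comap.trans (w.isEquiv_valuation_valuationSubring.comap _)⟩

/-- By uniqueness, the sum over extensions has a single term. Independence transfers between `w` and
the equivalent valuation attached to its ring. -/
theorem isDefectless_iff_exists_valIndep [IsPurelyInseparable F E] [FiniteDimensional F E]
    (v : Valuation F Γ₀) (w : Valuation E Γ₁) [v.HasExtension w] :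
    IsDefectless v E ↔ ∃ (n : ℕ) (z : Fin n → E), ValIndep (algebraMap F E) w z ∧
      ∀ s, s ∈ combinations (algebraMap F E) z := by
  have hW := hasExtension_valuationSubring v w
  have huniq : Unique {W : ValuationSubring E // v.HasExtension W.valuation} :=
    { default := ⟨w.valuationSubring, hW⟩
      uniq := fun W => by
        have := W.2
        have h := isEquiv_of_hasExtension v W.1.valuation w
        rw [Valuation.isEquiv_iff_valuationSubring, ValuationSubring.valuationSubring_valuation] at h
        exact Subtype.ext h }
  have hdef : (default : {W : ValuationSubring E // v.HasExtension W.valuation}) =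
      ⟨w.valuationSubring, hW⟩ := Subsingleton.elim _ _
  rw [IsDefectless, finsum_unique, and_iff_right ‹FiniteDimensional F E›, hdef]
  have heq := w.isEquiv_valuation_valuationSubring
  constructor
  · intro h
    obtain ⟨z, hz, hs⟩ := exists_valIndep_of_finrank_eq v w.valuationSubring.valuation h
    exact ⟨_, z, hz.of_isEquiv heq.symm, hs⟩
  · rintro ⟨n, z, hz, hs⟩
    exact (ValIndep.finrank_eq v w.valuationSubring.valuation (hz.of_isEquiv heq) hs).2

end PurelyInseparable

/-! ### Independence of the powers of a `p`-th root. -/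

section Powers

variable {F E Γ : Type*} [Field F] [Field E] [Algebra F E] [LinearOrderedCommGroupWithZero Γ]
  {p : ℕ} [Fact p.Prime]

/-- In characteristic `p` the only `p`-th root of `a` is `b`, which is not in `F`; so `X ^ p - a` is
irreducible and is the minimal polynomial of `b`. It is used for residue fields. -/
theorem linearIndependent_pow_of_pow_mem [CharP E p] {b : E} {a : F}
    (hb : b ∉ Set.range (algebraMap F E)) (ha : algebraMap F E a = b ^ p) {d : ℕ} (hd : d ≤ p) :
    LinearIndependent F fun i : Fin d => b ^ (i : ℕ) := by
  have hirr : Irreducible (Polynomial.X ^ p - Polynomial.C a) := by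
    refine X_pow_sub_C_irreducible_of_prime Fact.out fun c hc => hb ⟨c, ?_⟩
    have h : (algebraMap F E c - b) ^ p = 0 := by
      rw [sub_pow_char, ← map_pow, hc, ha, sub_self]
    exact sub_eq_zero.1 (pow_eq_zero_iff (Nat.Prime.ne_zero Fact.out) |>.1 h)
  have hmin := minpoly.eq_of_irreducible_of_monic (x := b) hirr (by simp [ha])
    (Polynomial.monic_X_pow_sub_C a (Nat.Prime.ne_zero Fact.out))
  have hdeg : d ≤ (minpoly F b).natDegree := by
    rwa [← hmin, Polynomial.natDegree_X_pow_sub_C]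
  exact (linearIndependent_pow b).comp (Fin.castLE hdeg) (Fin.castLE_injective hdeg)

theorem charP_residueField [CharP E p] (w : Valuation E Γ) :
    CharP (IsLocalRing.ResidueField w.valuationSubring) p := by
  rw [CharP.charP_iff_prime_eq_zero Fact.out,
    ← map_natCast (IsLocalRing.residue w.valuationSubring)]
  have : (p : w.valuationSubring) = 0 := Subtype.ext (by simp)
  rw [this, map_zero]

/-- If `b` is a `p`-th root of an element of `F` which is not closer to `F` than to `0`, then its
powers are valuation independent over `F`. -/
theorem valIndep_pow_of_best [CharP E p] (w : Valuation E Γ) {b : E}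
    (hb : b ∉ Set.range (algebraMap F E)) (hbp : b ^ p ∈ Set.range (algebraMap F E))
    (hbest : ∀ y : F, w b ≤ w (b - algebraMap F E y)) {d : ℕ} (hd : d ≤ p) :
    ValIndep (algebraMap F E) w fun i : Fin d => b ^ (i : ℕ) := by
  have hb0 : b ≠ 0 := fun h => hb ⟨0, by simp [h]⟩
  have hwb : w b ≠ 0 := by simpa using hb0
  obtain ⟨a, ha⟩ := hbp
  refine ⟨fun i => pow_ne_zero _ hb0, fun c i => ?_⟩
  by_cases hval : ∃ e : F, w b = w (algebraMap F E e)
  · obtain ⟨e, he⟩ := hval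
    have hE0 : algebraMap F E e ≠ 0 := by
      intro h0
      rw [h0, map_zero] at he
      exact hwb he
    have he0 : e ≠ 0 := fun h => hE0 (by simp [h])
    have hone : w (b / algebraMap F E e) = 1 := by
      rw [map_div₀, ← he, div_self hwb]
    let v := w.comap (algebraMap F E)
    have : v.HasExtension w := ⟨Valuation.IsEquiv.refl⟩
    have := charP_residueField (p := p) w
    let β : w.valuationSubring := ⟨b / algebraMap F E e, hone.le⟩
    have hαm : a / e ^ p ∈ v.valuationSubring := by
      change w (algebraMap F E (a / e ^ p)) ≤ 1
      rw [map_div₀, ha, map_pow, ← div_pow, map_pow, hone, one_pow]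
    have hli := linearIndependent_pow_of_pow_mem
      (F := IsLocalRing.ResidueField v.valuationSubring)
      (b := IsLocalRing.residue w.valuationSubring β)
      (a := IsLocalRing.residue v.valuationSubring ⟨a / e ^ p, hαm⟩) ?_ ?_ hd
    · have h := map_le_map_sum_of_residue v w (y := fun i : Fin d => β ^ (i : ℕ))
        (by simpa only [map_pow] using hli) (fun j => c j * e ^ (j : ℕ)) i
      have hterm : ∀ j : Fin d, algebraMap F E (c j * e ^ (j : ℕ)) *
          ((β ^ (j : ℕ) : w.valuationSubring) : E) = algebraMap F E (c j) * b ^ (j : ℕ) := by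
        intro j
        change _ * (b / algebraMap F E e) ^ (j : ℕ) = _
        rw [map_mul, map_pow, div_pow]
        field_simp
      simp only [hterm] at h
      rwa [map_mul, map_mul, map_pow, map_pow, ← he, ← map_pow, ← map_mul] at h
    -- If the residue of `b / e` came from some `y` in `F`, then `e * y` would be closer to `b` than
    -- `0`, against `hbest`.
    · rintro ⟨γ, hγ⟩
      obtain ⟨y, rfl⟩ := IsLocalRing.residue_surjective γ
      rw [Valuation.HasExtension.algebraMap_residue_eq_residue_algebraMap, eq_comm, ← sub_eq_zero,
        ← map_sub, residue_eq_zero_iff_lt_one] at hγ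
      have h1 : w (b / algebraMap F E e - algebraMap F E y) < 1 := hγ
      have h2 := hbest (e * y)
      have h3 : b - algebraMap F E (e * y) =
          (b / algebraMap F E e - algebraMap F E y) * algebraMap F E e := by
        rw [map_mul]; field_simp
      rw [h3, map_mul, ← he] at h2
      exact absurd (mul_lt_mul_of_pos_right h1 (zero_lt_iff.2 hwb)) (by rwa [one_mul, not_lt])
    · rw [Valuation.HasExtension.algebraMap_residue_eq_residue_algebraMap, ← map_pow]
      congr 1
      refine Subtype.ext ?_
      change algebraMap F E (a / e ^ p) = (b / algebraMap F E e) ^ p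
      rw [map_div₀, ha, map_pow, div_pow]
  · refine le_map_sum_of_ne w (fun j : Fin d => algebraMap F E (c j) * b ^ (j : ℕ)) ?_ i
    intro j k hjk hj0 h
    have hcj : c j ≠ 0 := fun h0 => hj0 (by simp [h0])
    have hck : c k ≠ 0 := by
      intro h0
      simp [h0, hcj, hb0] at h
    have hwcj : w (algebraMap F E (c j)) ≠ 0 := by simpa using hcj
    have hwck : w (algebraMap F E (c k)) ≠ 0 := by simpa using hck
    have hpow : w b ^ ((j : ℤ) - k) = w (algebraMap F E (c k / c j)) := by
      rw [map_mul, map_mul, map_pow, map_pow] at h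
      rw [zpow_sub₀ hwb, zpow_natCast, zpow_natCast, map_div₀, map_div₀]
      rw [div_eq_div_iff (pow_ne_zero _ hwb) hwcj, mul_comm, h]
    have hpowp : w b ^ (p : ℤ) = w (algebraMap F E a) := by
      rw [ha, map_pow, zpow_natCast]
    -- Equal values of two terms put `w b ^ (j - k)` in the value group of `F`, which also contains
    -- `w b ^ p`. As `0 < |j - k| < p`, Bézout puts `w b` itself there, contrary to the case
    -- assumption.
    have hcop : IsCoprime ((j : ℤ) - k) (p : ℤ) := by
      have hp : Prime (p : ℤ) := Nat.prime_iff_prime_int.1 Fact.out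
      refine (hp.coprime_iff_not_dvd.2 fun hdvd => hjk (Fin.ext ?_)).symm
      have h0 := Int.eq_zero_of_abs_lt_dvd hdvd (by rw [abs_lt]; omega)
      omega
    obtain ⟨r, s, hrs⟩ := hcop
    refine hval ⟨(c k / c j) ^ r * a ^ s, ?_⟩
    rw [map_mul, map_mul, map_zpow₀, map_zpow₀, map_zpow₀, map_zpow₀, ← hpow, ← hpowp, ← zpow_mul,
      ← zpow_mul, ← zpow_add₀ hwb, mul_comm _ r, mul_comm _ s, hrs, zpow_one]

end Powers

/-! ### Finite extensions of `K ^ p` inside `K`. -/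

section PPowers

variable {K Γ₀ : Type*} [Field K] [LinearOrderedCommGroupWithZero Γ₀] {p : ℕ} [Fact p.Prime]
  [CharP K p]

/-- The finite subextension `L` of `K` over `K ^ p` has a valuation basis. -/
def HasValuationBasis (v : Valuation K Γ₀) (L : IntermediateField (pPowers K p) K) : Prop :=
  ∃ (n : ℕ) (z : Fin n → K), ValIndep (algebraMap (pPowers K p) K) v z ∧
    ∀ s, s ∈ combinations (algebraMap (pPowers K p) K) z ↔ s ∈ L

/-- Every element of `K` has a best approximation in `L`. -/
def HasBestApproximations (v : Valuation K Γ₀) (L : IntermediateField (pPowers K p) K) : Prop :=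
  ∀ b : K, ∃ y ∈ L, ∀ z ∈ L, v (b - y) ≤ v (b - z)

theorem pow_mem_pPowers (x : K) : x ^ p ∈ pPowers K p :=
  ⟨x, rfl⟩

theorem mul_mem_intermediateField (L : IntermediateField (pPowers K p) K) (a : pPowers K p) {s : K}
    (hs : s ∈ L) : algebraMap (pPowers K p) K a * s ∈ L :=
  L.mul_mem (L.algebraMap_mem a) hs

theorem hasValuationBasis_bot (v : Valuation K Γ₀) :
    HasValuationBasis v (⊥ : IntermediateField (pPowers K p) K) := by
  refine ⟨1, fun _ => 1, ⟨fun _ => one_ne_zero, fun c i => ?_⟩, fun s => ?_⟩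
  · rw [Subsingleton.elim i 0]
    simp
  · rw [IntermediateField.mem_bot]
    constructor
    · rintro ⟨c, rfl⟩
      exact ⟨c 0, by simp⟩
    · rintro ⟨c, rfl⟩
      exact ⟨fun _ => c, by simp⟩

/-- Subtracting a best approximation replaces `b` by a generator `b'` of `L(b)` for which `0` is
already a best approximation. Its powers form a valuation basis over `L`, to be multiplied with the
one of `L`. -/
theorem HasValuationBasis.exists_adjoin {v : Valuation K Γ₀}
    {L : IntermediateField (pPowers K p) K} (hL : HasValuationBasis v L)
    (happ : HasBestApproximations v L) (b : K) :
    ∃ L' : IntermediateField (pPowers K p) K, HasValuationBasis v L' ∧ L ≤ L' ∧ b ∈ L' := by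
  by_cases hbL : b ∈ L
  · exact ⟨L, hL, le_rfl, hbL⟩
  obtain ⟨y, hy, hbest⟩ := happ b
  obtain ⟨n, z, hz, hzL⟩ := hL
  set b' := b - y with hb'
  have hb'L : b' ∉ L := fun h => hbL (by simpa [hb'] using L.add_mem h hy)
  have hb'p : b' ^ p ∈ Set.range (algebraMap L K) :=
    ⟨⟨b' ^ p, L.algebraMap_mem ⟨b' ^ p, pow_mem_pPowers b'⟩⟩, rfl⟩
  have hint : IsIntegral L b' := by
    obtain ⟨a, ha⟩ := hb'p
    exact IsIntegral.of_pow (Nat.Prime.pos Fact.out) (ha ▸ isIntegral_algebraMap)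
  have hdeg : (minpoly L b').natDegree ≤ p := by
    obtain ⟨a, ha⟩ := hb'p
    have h := Polynomial.natDegree_le_natDegree (minpoly.min L b'
      (Polynomial.monic_X_pow_sub_C a (Nat.Prime.ne_zero (Fact.out : p.Prime))) (by simp [ha]))
    rwa [Polynomial.natDegree_X_pow_sub_C] at h
  have hpow := valIndep_pow_of_best v (b := b') (F := L)
    (by rintro ⟨c, hc⟩; exact hb'L (hc ▸ c.2)) hb'p
    (fun c => by
      have := hbest (y + c) (L.add_mem hy c.2)
      rwa [← sub_sub] at this) hdeg
  have hzmem : ∀ i, z i ∈ L := fun i => (hzL _).1 (self_mem_combinations _ _ i)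
  let x : Fin n → L := fun i => ⟨z i, hzmem i⟩
  have hx : ValIndep (algebraMap (pPowers K p) L) (v.comap (algebraMap L K)) x := by
    refine ⟨fun i h => hz.1 i (congrArg Subtype.val h), fun c i => ?_⟩
    have := hz.2 c i
    rw [Valuation.comap_apply, Valuation.comap_apply, map_sum]
    exact this
  have hcomp : (algebraMap L K).comp (algebraMap (pPowers K p) L) = algebraMap (pPowers K p) K :=
    rfl
  have htow := hx.tower hpow
  rw [hcomp] at htow
  let L' : IntermediateField (pPowers K p) K :=
    (IntermediateField.adjoin L {b'}).restrictScalars (pPowers K p)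
  have hLL' : L ≤ L' := fun s hs =>
    (IntermediateField.adjoin L {b'}).algebraMap_mem ⟨s, hs⟩
  have hb'L' : b' ∈ L' := IntermediateField.mem_adjoin_simple_self L b'
  refine ⟨L', ⟨_, _, htow.comp_equiv finProdFinEquiv.symm, fun s => ?_⟩, hLL', ?_⟩
  · rw [combinations_comp_equiv]
    constructor
    · intro hs
      refine combinations_subset (V := L'.toSubfield.toAddSubgroup)
        (fun a s hs => mul_mem_intermediateField L' a hs) (fun k => ?_) hs
      exact L'.mul_mem (hLL' (hzmem k.2)) (pow_mem hb'L' _)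
    · intro hs
      let pb := IntermediateField.adjoin.powerBasis hint
      have hsum := congrArg (algebraMap _ K) (pb.basis.sum_repr ⟨s, hs⟩)
      have := mem_combinations_tower (φ := algebraMap (pPowers K p) L) (ψ := algebraMap L K)
        (x := x) (y := fun i : Fin (minpoly L b').natDegree => b' ^ (i : ℕ))
        (c := fun i => pb.basis.repr ⟨s, hs⟩ i) (fun k => by
          obtain ⟨c, hc⟩ := (hzL (pb.basis.repr ⟨s, hs⟩ k)).2 (SetLike.coe_mem _)
          exact ⟨c, Subtype.ext (by rw [← hc]; exact map_sum (algebraMap L K) _ _)⟩)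
      rw [hcomp] at this
      convert this using 1
      rw [map_sum] at hsum
      refine hsum.symm.trans (Finset.sum_congr rfl fun j _ => ?_)
      rw [Algebra.smul_def, map_mul, PowerBasis.basis_eq_pow, map_pow]
      rfl
  · simpa [hb'] using L'.add_mem hb'L' (hLL' hy)

theorem exists_hasValuationBasis_of_bestApproximations {v : Valuation K Γ₀}
    (H : ∀ L : IntermediateField (pPowers K p) K, HasValuationBasis v L →
      HasBestApproximations v L) (S : Finset K) :
    ∃ L : IntermediateField (pPowers K p) K, HasValuationBasis v L ∧ ∀ s ∈ S, s ∈ L := by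
  classical
  induction S using Finset.induction_on with
  | empty => exact ⟨⊥, hasValuationBasis_bot v, by simp⟩
  | insert b S _ ih =>
    obtain ⟨L, hL, hS⟩ := ih
    obtain ⟨L', hL', hle, hb⟩ := hL.exists_adjoin (H L hL) b
    refine ⟨L', hL', fun s hs => ?_⟩
    rcases Finset.mem_insert.1 hs with rfl | hs
    · exact hb
    · exact hle (hS s hs)

/-! ### Transport along Frobenius. -/

variable (K p) in
/-- The isomorphism of `K` onto `K ^ p`. -/
def toPPowers : K →+* pPowers K p := (frobenius K p).rangeRestrictField

theorem toPPowers_surjective : Function.Surjective (toPPowers K p) :=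
  fun ⟨_, y, hy⟩ => ⟨y, Subtype.ext hy⟩

theorem valIndep_frobenius_iff {v : Valuation K Γ₀} {ι : Type*} [Fintype ι] {x : ι → K} :
    ValIndep (frobenius K p) v x ↔ ValIndep (algebraMap (pPowers K p) K) v x := by
  refine and_congr_right fun _ => ⟨fun h c i => ?_, fun h c i => h (fun j => toPPowers K p (c j)) i⟩
  choose d hd using fun j => toPPowers_surjective (c j)
  obtain rfl : (fun j => toPPowers K p (d j)) = c := funext hd
  exact h d i

theorem combinations_frobenius {ι : Type*} [Fintype ι] (x : ι → K) :
    combinations (frobenius K p) x = combinations (algebraMap (pPowers K p) K) x := by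
  ext s
  constructor
  · rintro ⟨c, rfl⟩
    exact ⟨fun j => toPPowers K p (c j), rfl⟩
  · rintro ⟨c, rfl⟩
    choose d hd using fun j => toPPowers_surjective (c j)
    obtain rfl : (fun j => toPPowers K p (d j)) = c := funext hd
    exact ⟨d, rfl⟩

theorem isEquiv_comap_iterateFrobenius (v : Valuation K Γ₀) (n : ℕ) :
    v.IsEquiv (v.comap (iterateFrobenius K p n)) := by
  intro x y
  have hq : p ^ n ≠ 0 := pow_ne_zero _ (Nat.Prime.ne_zero Fact.out)
  simp only [Valuation.comap_apply, iterateFrobenius_def, map_pow]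
  exact (pow_le_pow_iff_left₀ zero_le zero_le hq).symm

/-- If every finite subset of `K` lies in a space with a valuation basis over `K ^ p`, then the
same holds over `K ^ (p ^ n)`. -/
theorem exists_valIndep_iterateFrobenius {v : Valuation K Γ₀}
    (H : ∀ S : Finset K, ∃ (m : ℕ) (x : Fin m → K), ValIndep (frobenius K p) v x ∧
      ∀ s ∈ S, s ∈ combinations (frobenius K p) x) (n : ℕ) (S : Finset K) :
    ∃ (m : ℕ) (x : Fin m → K), ValIndep (iterateFrobenius K p n) v x ∧
      ∀ s ∈ S, s ∈ combinations (iterateFrobenius K p n) x := by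
  classical
  induction n generalizing S with
  | zero =>
    refine ⟨1, fun _ => 1, ⟨fun _ => one_ne_zero, fun c i => ?_⟩, fun s _ => ⟨fun _ => s, ?_⟩⟩
    · rw [Subsingleton.elim i 0]
      simp
    · simp
  | succ n ih =>
    obtain ⟨m, y, hy, hyS⟩ := H S
    choose! c hc using hyS
    -- The induction hypothesis is applied to the `p`-th roots of the coefficients of `S`; Frobenius
    -- then carries the resulting family to one in `K ^ p` over `K ^ (p ^ (n + 1))`.
    obtain ⟨k, x, hx, hxS⟩ := ih (S.biUnion fun s => Finset.univ.image (c s))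
    have hx' : ValIndep (iterateFrobenius K p n) (v.comap (frobenius K p)) x := by
      refine hx.of_isEquiv ?_
      simpa [iterateFrobenius_one] using isEquiv_comap_iterateFrobenius (p := p) v 1
    have hcomp : (frobenius K p).comp (iterateFrobenius K p n) = iterateFrobenius K p (n + 1) := by
      ext a
      simp [iterateFrobenius_def, frobenius_def, pow_succ, pow_mul]
    have htow := hx'.tower hy
    rw [hcomp] at htow
    refine ⟨_, _, htow.comp_equiv finProdFinEquiv.symm, fun s hs => ?_⟩
    rw [combinations_comp_equiv, ← hcomp, ← hc s hs]
    exact mem_combinations_tower fun i => hxS _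
      (Finset.mem_biUnion.2 ⟨s, hs, Finset.mem_image_of_mem _ (Finset.mem_univ i)⟩)

/-- With `n` the exponent of `E`, raising to the power `p ^ n` embeds `E` into `K` as a
finite-dimensional `K ^ (p ^ n)`-subspace. It inherits a valuation basis from a larger space, and
pulling back gives one of `E` over `K`. -/
theorem isInseparablyDefectless_of_bestApproximations {v : Valuation K Γ₀}
    (H : ∀ L : IntermediateField (pPowers K p) K, HasValuationBasis v L →
      HasBestApproximations v L) : IsInseparablyDefectless v := by
  intro E _ _ _ _
  have hfrob := exists_valIndep_iterateFrobenius (v := v) (p := p) fun S => by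
    obtain ⟨L, ⟨m, x, hx, hxL⟩, hS⟩ := exists_hasValuationBasis_of_bestApproximations H S
    refine ⟨m, x, valIndep_frobenius_iff.2 hx, fun s hs => ?_⟩
    rw [combinations_frobenius]
    exact (hxL s).2 (hS s hs)
  let n := IsPurelyInseparable.exponent K E
  let φ : E →+* K := IsPurelyInseparable.iterateFrobenius K E p (n := n) le_rfl
  have hφ : ∀ a : K, φ (algebraMap K E a) = iterateFrobenius K p n a := fun a =>
    IsPurelyInseparable.iterateFrobenius_algebraMap E p le_rfl a
  have hext : v.HasExtension (v.comap φ) := by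
    refine ⟨fun x y => ?_⟩
    rw [Valuation.comap_apply, Valuation.comap_apply, Valuation.comap_apply, Valuation.comap_apply,
      hφ, hφ]
    exact isEquiv_comap_iterateFrobenius v n x y
  rw [isDefectless_iff_exists_valIndep v (v.comap φ)]
  classical
  let e := Module.finBasis K E
  obtain ⟨m, x, hx, hxS⟩ := hfrob n (Finset.univ.image fun i => φ (e i))
  have hV : φ.range.toAddSubgroup ≤ combinations (iterateFrobenius K p n) x := by
    rintro _ ⟨s, rfl⟩
    rw [← e.sum_repr s, map_sum]
    refine AddSubgroup.sum_mem _ fun i _ => ?_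
    rw [Algebra.smul_def, map_mul, hφ]
    exact mul_mem_combinations _ (hxS _ (Finset.mem_image_of_mem _ (Finset.mem_univ i)))
  obtain ⟨⟨k, y, hy, hyV⟩, -⟩ := hx.exists_basis_and_approximation (V := φ.range.toAddSubgroup)
    (by
      rintro a _ ⟨s, rfl⟩
      exact ⟨algebraMap K E a * s, by rw [map_mul, hφ]⟩) hV
  have hymem : ∀ i, ∃ z, φ z = y i := fun i => by
    have : y i ∈ φ.range.toAddSubgroup := hyV ▸ self_mem_combinations _ y i
    exact this
  choose z hz using hymem
  have hφsum : ∀ c : Fin k → K, φ (∑ j, algebraMap K E (c j) * z j) =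
      ∑ j, iterateFrobenius K p n (c j) * y j := fun c => by
    simp only [map_sum, map_mul, hφ, hz]
  refine ⟨k, z, ⟨fun i h => hy.1 i (by rw [← hz, h, map_zero]), fun c i => ?_⟩, fun s => ?_⟩
  · rw [Valuation.comap_apply, Valuation.comap_apply, hφsum, map_mul, hφ, hz]
    exact hy.2 c i
  · have hs : φ s ∈ combinations (iterateFrobenius K p n) y := by
      rw [hyV]; exact ⟨s, rfl⟩
    obtain ⟨c, hc⟩ := hs
    exact ⟨c, φ.injective ((hφsum c).trans hc)⟩

theorem isPurelyInseparable_pPowers (L : IntermediateField (pPowers K p) K) :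
    IsPurelyInseparable (pPowers K p) L := by
  rw [isPurelyInseparable_iff_pow_mem (pPowers K p) p]
  exact fun x => ⟨1, ⟨(x : K) ^ p, pow_mem_pPowers _⟩, Subtype.ext (by rw [pow_one]; rfl)⟩

theorem hasExtension_pPowers (v : Valuation K Γ₀) (L : IntermediateField (pPowers K p) K) :
    (onPPowers v p).HasExtension (v.comap (algebraMap L K)) :=
  ⟨Valuation.IsEquiv.refl⟩

/-- Through `K ≅ K ^ p` the field `L` becomes a finite purely inseparable extension of `K`. Since `v
(a ^ p)` orders `K` as `v` does, the restriction of `v` to `L` extends `v` up to equivalence. -/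
theorem IsInseparablyDefectless.hasValuationBasis {v : Valuation K Γ₀}
    (hv : IsInseparablyDefectless v) (L : IntermediateField (pPowers K p) K)
    [FiniteDimensional (pPowers K p) L] : HasValuationBasis v L := by
  let φ : K →+* L := (algebraMap (pPowers K p) L).comp (toPPowers K p)
  let _ : Algebra K L := φ.toAlgebra
  have hφ : ∀ a : K, algebraMap L K (algebraMap K L a) = a ^ p := fun _ => rfl
  have hfin : FiniteDimensional K L := by
    have h1 : (algebraMap (pPowers K p) L).Finite := RingHom.finite_algebraMap.2 inferInstance
    have h2 : φ.Finite := h1.comp (RingHom.Finite.of_surjective _ toPPowers_surjective)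
    exact h2
  have hpi : IsPurelyInseparable K L := by
    rw [isPurelyInseparable_iff_pow_mem K p]
    exact fun x => ⟨1, x, Subtype.ext (by rw [pow_one]; rfl)⟩
  have hext : v.HasExtension (v.comap (algebraMap L K)) := by
    refine ⟨fun x y => ?_⟩
    have := isEquiv_comap_iterateFrobenius (p := p) v 1 x y
    simpa [hφ, iterateFrobenius_one, frobenius_def] using this
  obtain ⟨n, z, hz, hs⟩ := (isDefectless_iff_exists_valIndep v (v.comap (algebraMap L K))).1 (hv L)
  have hsum : ∀ c : Fin n → K, algebraMap L K (∑ j, algebraMap K L (c j) * z j) =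
      ∑ j, frobenius K p (c j) * z j := fun c => by
    simp only [map_sum, map_mul, hφ, frobenius_def]
    rfl
  refine ⟨n, fun i => z i, ?_, fun s => ?_⟩
  · refine valIndep_frobenius_iff.1 ⟨fun i h => hz.1 i (Subtype.ext h), fun c i => ?_⟩
    have := hz.2 c i
    rw [Valuation.comap_apply, Valuation.comap_apply, hsum, map_mul, hφ] at this
    exact this
  · rw [← combinations_frobenius]
    constructor
    · rintro ⟨c, rfl⟩
      change ∑ j, frobenius K p (c j) * (z j : K) ∈ L
      rw [← hsum]
      exact SetLike.coe_mem _
    · intro h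
      obtain ⟨c, hc⟩ := hs ⟨s, h⟩
      exact ⟨c, (hsum c).symm.trans (congrArg (algebraMap L K) hc)⟩

/-- Both `L` and `b` lie in a finite extension of `K ^ p`, which has a valuation basis; `L` is a
subspace of it. -/
theorem IsInseparablyDefectless.hasBestApproximations {v : Valuation K Γ₀}
    (hv : IsInseparablyDefectless v) (L : IntermediateField (pPowers K p) K)
    [FiniteDimensional (pPowers K p) L] : HasBestApproximations v L := by
  intro b
  have hint : IsIntegral (pPowers K p) b :=
    IsIntegral.of_pow (Nat.Prime.pos Fact.out)
      (isIntegral_algebraMap (x := (⟨b ^ p, pow_mem_pPowers b⟩ : pPowers K p)))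
  have := IntermediateField.adjoin.finiteDimensional hint
  obtain ⟨n, x, hx, hxL⟩ := hv.hasValuationBasis (L ⊔ IntermediateField.adjoin (pPowers K p) {b})
  exact (hx.exists_basis_and_approximation (V := L.toSubfield.toAddSubgroup)
    (fun a s hs => mul_mem_intermediateField L a hs)
    (fun s hs => (hxL s).2 ((le_sup_left : L ≤ _) hs))).2 b
    ((hxL b).2 ((le_sup_right : IntermediateField.adjoin (pPowers K p) {b} ≤ _)
      (IntermediateField.mem_adjoin_simple_self _ b)))

end PPowers

/-! ### Extremality of `p`-polynomials as best approximation. -/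

section Extremality

variable {K Γ₀ : Type*} [Field K] [LinearOrderedCommGroupWithZero Γ₀] {p : ℕ}

theorem eval_pPolynomial {n : ℕ} (b : K) (c x : Fin n → K) :
    MvPolynomial.eval x (pPolynomial p b c) = b - ∑ i, c i * x i ^ p := by
  simp [pPolynomial]

variable [Fact p.Prime] [CharP K p] {L : IntermediateField (pPowers K p) K} {n : ℕ}

theorem sum_basis_mem (B : Module.Basis (Fin n) (pPowers K p) L) (x : Fin n → K) :
    ∑ i, (B i : K) * x i ^ p ∈ L :=
  L.sum_mem fun i _ => L.mul_mem (B i).2 (L.algebraMap_mem ⟨x i ^ p, pow_mem_pPowers _⟩)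

theorem coe_sum_smul_basis (B : Module.Basis (Fin n) (pPowers K p) L) (x : Fin n → K) :
    ((∑ i, toPPowers K p (x i) • B i : L) : K) = ∑ i, (B i : K) * x i ^ p := by
  change algebraMap L K _ = _
  rw [map_sum]
  refine Finset.sum_congr rfl fun i _ => ?_
  rw [Algebra.smul_def, map_mul, mul_comm]
  rfl

theorem exists_sum_basis_eq (B : Module.Basis (Fin n) (pPowers K p) L) {z : K} (hz : z ∈ L) :
    ∃ x : Fin n → K, ∑ i, (B i : K) * x i ^ p = z := by
  choose x hx using fun i => toPPowers_surjective (B.repr ⟨z, hz⟩ i)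
  refine ⟨x, ?_⟩
  rw [← coe_sum_smul_basis]
  simp only [hx, B.sum_repr]

theorem isKExtremal_pPolynomial_iff (v : Valuation K Γ₀) (B : Module.Basis (Fin n) (pPowers K p) L)
    (b : K) : IsKExtremal v (pPolynomial p b fun i => (B i : K)) ↔
      ∃ y ∈ L, ∀ z ∈ L, v (b - y) ≤ v (b - z) := by
  simp only [IsKExtremal, eval_pPolynomial]
  constructor
  · rintro ⟨_, ⟨x, rfl⟩, hx⟩
    refine ⟨_, sum_basis_mem B x, fun z hz => ?_⟩
    obtain ⟨t, rfl⟩ := exists_sum_basis_eq B hz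
    exact hx ⟨t, rfl⟩
  · rintro ⟨y, hy, hbest⟩
    obtain ⟨x, rfl⟩ := exists_sum_basis_eq B hy
    refine ⟨_, ⟨x, rfl⟩, ?_⟩
    rintro _ ⟨t, rfl⟩
    exact hbest _ (sum_basis_mem B t)

/-- A valuation basis of `L` inside `K` is a basis of `L` over `K ^ p`. -/
theorem exists_basis_of_valIndep {v : Valuation K Γ₀} {z : Fin n → K}
    (hz : ValIndep (algebraMap (pPowers K p) K) v z)
    (hL : ∀ s, s ∈ combinations (algebraMap (pPowers K p) K) z ↔ s ∈ L) :
    ∃ B : Module.Basis (Fin n) (pPowers K p) L, ∀ i, (B i : K) = z i := by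
  have hzL : ∀ i, z i ∈ L := fun i => (hL _).1 (self_mem_combinations _ z i)
  have hli : LinearIndependent (pPowers K p) fun i => (⟨z i, hzL i⟩ : L) :=
    LinearIndependent.of_comp L.val.toLinearMap hz.linearIndependent
  refine ⟨Module.Basis.mk hli fun s _ => ?_, fun i => by rw [Module.Basis.mk_apply]⟩
  obtain ⟨c, hc⟩ := (hL s).2 s.2
  refine (Submodule.mem_span_range_iff_exists_fun _).2 ⟨c, Subtype.ext ?_⟩
  rw [← hc]
  change algebraMap L K _ = _
  rw [map_sum]
  refine Finset.sum_congr rfl fun i _ => ?_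
  rw [Algebra.smul_def, map_mul]
  rfl

theorem isInseparablyDefectless_iff_isKExtremal (v : Valuation K Γ₀) :
    IsInseparablyDefectless v ↔
      ∀ (n : ℕ) (L : IntermediateField (pPowers K p) K)
        (B : Module.Basis (Fin n) (pPowers K p) L) (b : K),
        IsKExtremal v (pPolynomial p b (fun i => (B i : K))) := by
  constructor
  · intro hv n L B b
    have : FiniteDimensional (pPowers K p) L := B.finiteDimensional_of_finite
    exact (isKExtremal_pPolynomial_iff v B b).2 (hv.hasBestApproximations L b)
  · intro H
    refine isInseparablyDefectless_of_bestApproximations (p := p) fun L hL b => ?_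
    obtain ⟨n, z, hz, hzL⟩ := hL
    obtain ⟨B, -⟩ := exists_basis_of_valIndep hz hzL
    exact (isKExtremal_pPolynomial_iff v B b).1 (H n L B b)

/-- If the values of a valuation basis are smaller than all positive values of `K ^ p`, then only
integral coordinates give integral combinations. -/
theorem mem_valuationSubring_of_sum {v : Valuation K Γ₀} (B : Module.Basis (Fin n) (pPowers K p) L)
    (hB : ∀ (x : Fin n → K) i, v ((B i : K) * x i ^ p) ≤ v (∑ j, (B j : K) * x j ^ p))
    (hsmall : ∀ i, ∀ γ ∈ valueGroup (onPPowers v p), γ < 1 → (γ : Γ₀) < v (B i : K))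
    {x : Fin n → K} (hx : v (∑ j, (B j : K) * x j ^ p) ≤ 1) (i : Fin n) :
    x i ∈ v.valuationSubring := by
  rw [Valuation.mem_valuationSubring_iff]
  by_contra! h
  have hp : p ≠ 0 := Nat.Prime.ne_zero Fact.out
  have hx0 : x i ≠ 0 := by
    intro h0
    rw [h0, map_zero] at h
    exact absurd h (by simp)
  have hlt : (v (x i) ^ p)⁻¹ < 1 := inv_lt_one_of_one_lt₀ (one_lt_pow₀ h hp)
  have hu0 : toPPowers K p (x i)⁻¹ ≠ 0 := by simpa using hx0
  have hval : v ((toPPowers K p (x i)⁻¹ : pPowers K p) : K) = (v (x i) ^ p)⁻¹ := by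
    change v ((x i)⁻¹ ^ p) = _
    rw [map_pow, map_inv₀, inv_pow]
  -- If `x i` is not integral, `(x i)⁻¹ ^ p` has positive additive value in `K ^ p`, so `hsmall`
  -- forces the `i`-th term to be non-integral too.
  have hs := hsmall i (Units.map (onPPowers v p : pPowers K p →* Γ₀) (Units.mk0 _ hu0)) ⟨_, rfl⟩
    (by rw [← Units.val_lt_val]; exact hval.trans_lt hlt)
  have hs' : (v (x i) ^ p)⁻¹ < v (B i) := hval.symm.trans_lt hs
  have h1 : v (B i) * v (x i) ^ p ≤ 1 := by
    rw [← map_pow, ← map_mul]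
    exact (hB x i).trans hx
  have hpos : 0 < v (x i) ^ p := pow_pos (zero_lt_one.trans h) p
  exact absurd ((inv_lt_iff_one_lt_mul₀ hpos).1 hs') (not_lt.2 h1)

/-- A best approximation of an integral `b` is no worse than `0`, hence integral, and so are its
coordinates. The optimum over `K` is thus attained over the valuation ring. -/
theorem isOExtremal_of_isInseparablyDefectless {v : Valuation K Γ₀}
    (hv : IsInseparablyDefectless v) (B : Module.Basis (Fin n) (pPowers K p) L) {b : K}
    (hB : IsValuationBasis (v.comap (algebraMap L K)) B) (hb : b ∈ v.valuationSubring)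
    (hsmall : ∀ i, ∀ γ ∈ valueGroup (onPPowers v p), γ < 1 → (γ : Γ₀) < v (B i : K)) :
    IsOExtremal v (pPolynomial p b (fun i => (B i : K))) := by
  have : FiniteDimensional (pPowers K p) L := B.finiteDimensional_of_finite
  have hB' : ∀ (x : Fin n → K) i, v ((B i : K) * x i ^ p) ≤ v (∑ j, (B j : K) * x j ^ p) := by
    intro x i
    have h := (hB fun j => toPPowers K p (x j)).2 ⟨i, rfl⟩
    simp only [Valuation.comap_apply] at h
    rw [mul_comm, ← coe_sum_smul_basis]
    exact h
  obtain ⟨y, hy, hbest⟩ := hv.hasBestApproximations L b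
  obtain ⟨x, rfl⟩ := exists_sum_basis_eq B hy
  have hb0 := hbest 0 L.zero_mem
  rw [sub_zero] at hb0
  have hxle : v (∑ j, (B j : K) * x j ^ p) ≤ 1 := by
    have h := v.map_sub b (b - ∑ j, (B j : K) * x j ^ p)
    rw [sub_sub_cancel] at h
    exact h.trans (max_le hb (hb0.trans hb))
  simp only [IsOExtremal, eval_pPolynomial]
  refine ⟨_, ⟨x, mem_valuationSubring_of_sum B hB' hsmall hxle, rfl⟩, ?_⟩
  rintro _ ⟨t, -, rfl⟩
  exact hbest _ (sum_basis_mem B t)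

/-- If the value group is divisible or a `ℤ`-group, then every value can be shifted by `p`-th powers
to a nonnegative value smaller than all positive values of `K ^ p`. -/
theorem exists_mul_pow_small {v : Valuation K Γ₀}
    (hG : HasDivisibleValueGroup v ∨ HasZGroupValueGroup v) {z : K} (hz : z ≠ 0) :
    ∃ h : K, h ≠ 0 ∧ v (z * h ^ p) ≤ 1 ∧
      ∀ γ ∈ valueGroup (onPPowers v p), γ < 1 → (γ : Γ₀) < v (z * h ^ p) := by
  have hp : 0 < p := Nat.Prime.pos Fact.out
  have hmem : ∀ {γ : Γ₀ˣ}, γ ∈ valueGroup v → ∃ h : K, h ≠ 0 ∧ v h = γ := by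
    rintro _ ⟨h, rfl⟩
    exact ⟨h, h.ne_zero, rfl⟩
  have hg : Units.map (v : K →* Γ₀) (Units.mk0 z hz) ∈ valueGroup v := ⟨_, rfl⟩
  rcases hG with hG | ⟨a, haG, ha1, hleast, hG⟩
  · obtain ⟨γ, hγ, hγz⟩ := hG p hp _ ((valueGroup v).inv_mem hg)
    obtain ⟨h, hh0, hh⟩ := hmem hγ
    have hone : v (z * h ^ p) = 1 := by
      have := congrArg Units.val hγz
      rw [Units.val_pow_eq_pow_val, ← hh, Units.val_inv_eq_inv_val] at this
      rw [map_mul, map_pow, this]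
      exact mul_inv_cancel₀ (by simpa using hz)
    refine ⟨h, hh0, hone.le, fun γ _ hγ => ?_⟩
    rw [hone]
    exact_mod_cast hγ
  · obtain ⟨γ, hγ, k, hk⟩ := hG p hp _ hg
    obtain ⟨α, hα0, hα⟩ := hmem haG
    obtain ⟨η, hη0, hη⟩ := hmem hγ
    have hz' : v z = v η ^ p * v α ^ k := by
      rw [hη, hα]
      have := congrArg Units.val hk
      simpa using this
    have hp' : (0 : ℤ) < p := by exact_mod_cast hp
    -- Dividing `k` by `p` with remainder leaves a power of `α` with exponent in `[0, p)`, while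
    -- every positive additive value of `K ^ p` is at least `p` times that of `α`.
    have hval : v (z * (η⁻¹ * α ^ (-(k / p))) ^ p) = v α ^ (k % p) := by
      have hη' : v η ≠ 0 := by simpa using hη0
      have hα' : v α ≠ 0 := by simpa using hα0
      rw [map_mul, hz', map_pow, map_mul, map_inv₀, map_zpow₀, mul_pow, inv_pow,
        ← zpow_natCast (v α ^ _), ← zpow_mul, mul_mul_mul_comm, mul_inv_cancel₀
        (pow_ne_zero _ hη'), one_mul, ← zpow_add₀ hα']
      congr 1
      have := Int.emod_def k p
      rw [this]; ring
    have hα1 : v α < 1 := by rw [hα]; exact_mod_cast ha1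
    obtain ⟨m, hm⟩ := Int.eq_ofNat_of_zero_le (Int.emod_nonneg k hp'.ne')
    have hmp : m < p := by
      have := Int.emod_lt_of_pos k hp'
      omega
    rw [hm, zpow_natCast] at hval
    refine ⟨η⁻¹ * α ^ (-(k / p)), mul_ne_zero (inv_ne_zero hη0) (zpow_ne_zero _ hα0), ?_, ?_⟩
    · rw [hval]
      exact pow_le_one₀ zero_le hα1.le
    · rintro _ ⟨u, rfl⟩ hu
      obtain ⟨t, ht⟩ := toPPowers_surjective (u : pPowers K p)
      have hut : (Units.map (onPPowers v p : pPowers K p →* Γ₀) u : Γ₀) = v t ^ p := by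
        change v ((u : pPowers K p) : K) = _
        rw [← ht, ← map_pow]
        rfl
      have ht0 : t ≠ 0 := by
        rintro rfl
        exact u.ne_zero (by rw [← ht, map_zero])
      have hu' : v t ^ p < 1 := by rw [← hut]; exact_mod_cast hu
      have ht1 : v t < 1 := by
        by_contra! h
        exact absurd (one_le_pow₀ h) (not_le.2 hu')
      have hta : v t ≤ v α := by
        have := hleast (Units.map (v : K →* Γ₀) (Units.mk0 t ht0)) ⟨_, rfl⟩
          (by rw [← Units.val_lt_val]; exact ht1)
        rw [hα]
        exact Units.val_le_val.2 this
      rw [hut, hval]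
      calc v t ^ p ≤ v α ^ p := pow_le_pow_left₀ zero_le hta p
        _ < v α ^ m := pow_lt_pow_right_of_lt_one₀ (zero_lt_iff.2 (by simpa using hα0)) hα1 hmp

/-- Scaling the members of a valuation basis by nonzero elements of `K ^ p` gives a valuation
basis. -/
theorem ValIndep.scale {v : Valuation K Γ₀} {z : Fin n → K}
    (hz : ValIndep (algebraMap (pPowers K p) K) v z) {h : Fin n → K} (hh : ∀ i, h i ≠ 0) :
    ValIndep (algebraMap (pPowers K p) K) v (fun i => z i * h i ^ p) ∧
      combinations (algebraMap (pPowers K p) K) (fun i => z i * h i ^ p) =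
        combinations (algebraMap (pPowers K p) K) z := by
  rw [← valIndep_frobenius_iff, ← combinations_frobenius, ← combinations_frobenius]
  rw [← valIndep_frobenius_iff] at hz
  refine ⟨⟨fun i => mul_ne_zero (hz.1 i) (pow_ne_zero _ (hh i)), fun c i => ?_⟩, ?_⟩
  · simpa only [frobenius_def, mul_pow, mul_assoc, mul_comm (z _)] using
      hz.2 (fun j => c j * h j) i
  · ext s
    constructor
    · rintro ⟨c, rfl⟩
      exact ⟨fun j => c j * h j, Finset.sum_congr rfl fun j _ => by
        simp only [frobenius_def, mul_pow]; ring⟩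
    · rintro ⟨c, rfl⟩
      refine ⟨fun j => c j / h j, Finset.sum_congr rfl fun j _ => ?_⟩
      have := pow_ne_zero p (hh j)
      simp only [frobenius_def, div_pow]
      field_simp

theorem isValuationBasis_of_valIndep {v : Valuation K Γ₀} {z : Fin n → K}
    (hz : ValIndep (algebraMap (pPowers K p) K) v z) (B : Module.Basis (Fin n) (pPowers K p) L)
    (hB : ∀ i, (B i : K) = z i) : IsValuationBasis (v.comap (algebraMap L K)) B := by
  intro c
  have hterm : ∀ i, algebraMap L K (c i • B i) = algebraMap (pPowers K p) K (c i) * z i := by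
    intro i
    rw [← hB, Algebra.smul_def, map_mul]
    rfl
  have hle : ∀ i, v (algebraMap L K (c i • B i)) ≤ v (algebraMap L K (∑ j, c j • B j)) := by
    intro i
    simp only [map_sum, hterm]
    exact hz.2 c i
  have := B.index_nonempty
  obtain ⟨k, -, hk⟩ := Finset.exists_max_image Finset.univ
    (fun j => v (algebraMap L K (c j • B j))) Finset.univ_nonempty
  refine ⟨⟨k, le_antisymm (hle k) ?_⟩, ?_⟩
  · rw [Valuation.comap_apply, map_sum]
    exact v.map_sum_le hk
  · rintro _ ⟨i, rfl⟩
    exact hle i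

theorem isDefectless_of_valIndep {v : Valuation K Γ₀} {z : Fin n → K}
    (hz : ValIndep (algebraMap (pPowers K p) K) v z) (B : Module.Basis (Fin n) (pPowers K p) L)
    (hB : ∀ i, (B i : K) = z i) : IsDefectless (onPPowers v p) L := by
  have := isPurelyInseparable_pPowers L
  have := hasExtension_pPowers v L
  have : FiniteDimensional (pPowers K p) L := B.finiteDimensional_of_finite
  rw [isDefectless_iff_exists_valIndep (onPPowers v p) (v.comap (algebraMap L K))]
  refine ⟨n, B, ⟨B.ne_zero, fun c i => ?_⟩, fun s => ⟨B.repr s, ?_⟩⟩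
  · have h := (isValuationBasis_of_valIndep hz B hB c).2 ⟨i, rfl⟩
    simpa only [Algebra.smul_def] using h
  · simpa only [Algebra.smul_def] using B.sum_repr s

/-- Multiplying the basis vectors by `p`-th powers keeps `L`, and multiplying `b` by `g ^ p ∈ L`
preserves the approximation problem, so `𝒪`-extremality becomes applicable. -/
theorem bestApproximations_of_isOExtremal {v : Valuation K Γ₀}
    (hG : HasDivisibleValueGroup v ∨ HasZGroupValueGroup v)
    (H : ∀ (n : ℕ) (L : IntermediateField (pPowers K p) K)
      (B : Module.Basis (Fin n) (pPowers K p) L) (b : K),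
      IsDefectless (onPPowers v p) L →
      IsValuationBasis (v.comap (algebraMap L K)) B →
      b ∈ v.valuationSubring →
      (∀ i, (B i : K) ∈ v.valuationSubring) →
      (∀ i, ∀ γ ∈ valueGroup (onPPowers v p), γ < 1 → (γ : Γ₀) < v (B i : K)) →
      IsOExtremal v (pPolynomial p b (fun i => (B i : K))))
    (hL : HasValuationBasis v L) : HasBestApproximations v L := by
  intro b
  rcases eq_or_ne b 0 with rfl | hb0
  · exact ⟨0, L.zero_mem, fun z _ => by simp⟩
  obtain ⟨n, z, hz, hzL⟩ := hL
  choose h hh0 hh1 hhs using fun i => exists_mul_pow_small hG (p := p) (hz.1 i)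
  obtain ⟨hz', hcomb⟩ := hz.scale hh0
  simp only [← hcomb] at hzL
  obtain ⟨B, hB⟩ := exists_basis_of_valIndep hz' hzL
  obtain ⟨g, hg0, hg1, -⟩ := exists_mul_pow_small hG (p := p) hb0
  have hext := H n L B (b * g ^ p) (isDefectless_of_valIndep hz' B hB)
    (isValuationBasis_of_valIndep hz' B hB) hg1 (fun i => by rw [hB]; exact hh1 i)
    (fun i => by rw [hB]; exact hhs i)
  have hB' : ∀ (x : Fin n → K) i, v ((B i : K) * x i ^ p) ≤ v (∑ j, (B j : K) * x j ^ p) := by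
    intro x i
    simp only [hB]
    simpa only [frobenius_def, mul_comm (_ ^ p)] using (valIndep_frobenius_iff.2 hz').2 x i
  simp only [IsOExtremal, eval_pPolynomial] at hext
  obtain ⟨_, ⟨x, -, rfl⟩, hx⟩ := hext
  have hgL : g ^ p ∈ L := L.algebraMap_mem ⟨g ^ p, pow_mem_pPowers g⟩
  have hgp : g ^ p ≠ 0 := pow_ne_zero _ hg0
  have hvg : 0 < v (g ^ p) := zero_lt_iff.2 (v.ne_zero_iff.2 hgp)
  have hbest : ∀ t ∈ L, v (b * g ^ p - ∑ j, (B j : K) * x j ^ p) ≤ v (b * g ^ p - t) := by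
    intro t ht
    obtain ⟨y, rfl⟩ := exists_sum_basis_eq B ht
    by_cases hy : v (∑ j, (B j : K) * y j ^ p) ≤ 1
    · exact hx ⟨y, mem_valuationSubring_of_sum B hB'
        (fun i => by rw [hB]; exact hhs i) hy, rfl⟩
    -- A non-integral element of `L` dominates the difference, so the integral point `0` already
    -- does better.
    · have hlt : v (b * g ^ p) < v (∑ j, (B j : K) * y j ^ p) := hg1.trans_lt (not_le.1 hy)
      have h0 := hx ⟨0, fun i => by simp, rfl⟩
      have hp : p ≠ 0 := Nat.Prime.ne_zero Fact.out
      simp only [Pi.zero_apply, zero_pow hp, mul_zero, Finset.sum_const_zero, sub_zero] at h0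
      rw [Valuation.map_sub_eq_of_lt_right _ hlt]
      exact h0.trans hlt.le
  refine ⟨(∑ j, (B j : K) * x j ^ p) / g ^ p, L.div_mem (sum_basis_mem B x) hgL, fun t ht => ?_⟩
  have h1 := hbest (t * g ^ p) (L.mul_mem ht hgL)
  have h2 : b * g ^ p - ∑ j, (B j : K) * x j ^ p =
      (b - (∑ j, (B j : K) * x j ^ p) / g ^ p) * g ^ p := by
    field_simp
  rw [h2, ← sub_mul, map_mul, map_mul] at h1
  exact le_of_mul_le_mul_right h1 hvg

end Extremality

end DefectValuation

open DefectValuation in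
theorem theorem1p3 {K Γ₀ : Type*} [Field K] [LinearOrderedCommGroupWithZero Γ₀]
    (p : ℕ) [Fact p.Prime] [CharP K p] (v : Valuation K Γ₀) :
    (IsInseparablyDefectless v ↔
      ∀ (n : ℕ) (L : IntermediateField (pPowers K p) K)
        (B : Module.Basis (Fin n) (pPowers K p) L) (b : K),
        IsKExtremal v (pPolynomial p b (fun i => (B i : K)))) ∧
    (HasDivisibleValueGroup v ∨ HasZGroupValueGroup v →
      (IsInseparablyDefectless v ↔
        ∀ (n : ℕ) (L : IntermediateField (pPowers K p) K)
          (B : Module.Basis (Fin n) (pPowers K p) L) (b : K),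
          IsDefectless (onPPowers v p) L →
          IsValuationBasis (v.comap (algebraMap L K)) B →
          b ∈ v.valuationSubring →
          (∀ i, (B i : K) ∈ v.valuationSubring) →
          (∀ i, ∀ γ ∈ valueGroup (onPPowers v p),
            γ < 1 → (γ : Γ₀) < v (B i : K)) →
          IsOExtremal v (pPolynomial p b (fun i => (B i : K))))) := by
  refine ⟨isInseparablyDefectless_iff_isKExtremal v, fun hG => ⟨?_, fun H => ?_⟩⟩
  · intro hv n L B b _ hB hb _ hsmall
    exact isOExtremal_of_isInseparablyDefectless hv B hB hb hsmall
  · exact isInseparablyDefectless_of_bestApproximations (p := p) fun L hL =>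
      bestApproximations_of_isOExtremal hG H hL
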